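/- Let $n\ge 0$, $\mathbf{x}=x_1,\dots,x_n$, $\mathbf{y}=y_1,\dots,y_n$. The group $S_n\times S_n$ acts on $R=\mathbb{C}[\mathbf{x},\mathbf{y}]$ by $(\sigma,\tau)x_i=x_{\sigma(i)}$, $(\sigma,\tau)y_i=y_{\tau(i)}$. Let $\mathcal I$ be the ideal of $R$ generated by the $S_n\times S_n$-invariant polynomials without constant term, and let $\mathcal H=\mathcal H_{S_n\times S_n}=\mathcal I^{\perp}$ be its orthogonal complement for $\langle P,Q\rangle=P(\partial\mathbf{x},\partial\mathbf{y})\,Q\,|_{\mathbf{x}=\mathbf{y}=0}$. The space $\mathcal H$ is stable under the diagonal action of $S_n$ ($\sigma x_i=x_{\sigma(i)}$, $\sigma y_i=y_{\sigma(i)}$) and bigraded by degree in $\mathbf{x}$ and in $\mathbf{y}$; let $\mathcal H_{j,k}$ be its component of bidegree $(j,k)$ and $\chi_{j,k}$ the character of $S_n$ on it. The bigraded Frobenius characteristic of $\mathcal H$ is the symmetric function $$F_n(\mathbf{z};q,t)=\sum_{j,k\ge 0}q^jt^k\,\frac1{n!}\sum_{\sigma\in S_n}\chi_{j,k}(\sigma)\,p_{\lambda(\sigma)}(\mathbf{z})$$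 in the variables $\mathbf{z}=z_1,z_2,z_3,\dots$, where $\lambda(\sigma)$ is the cycle type of $\sigma$ (fixed points included), $p_k=\sum_i z_i^k$ and $p_\lambda=p_{\lambda_1}p_{\lambda_2}\cdots$. The sum over $(j,k)$ has finitely many nonzero terms. The parameters $q,t$ are elements of an extension field $K$ of $\mathbb{C}$ (for instance the two indeterminates of $K=\mathbb{C}(q,t)$), and $F_n$ is an element of the ring $\Lambda_K$ of symmetric functions over $K$. There is a unique $K$-linear map $\omega:\Lambda_K\to\Lambda_K$ with $\omega(s_\lambda)=s_{\lambda'}$ for all partitions $\lambda$, where $s_\lambda$ is the Schur function and $\lambda'$ the conjugate partition of $\lambda$. For all $n\ge 0$ and all $q,t\in K$: 1. $F_n(\mathbf{z};t,q)=F_n(\mathbf{z};q,t)$; 2. if $q\neq0$ and $t\ne 0$, then $F_n(\mathbf{z};t,q)=(qt)^{\binom n2}F_n(\mathbf{z};q^{-1},t^{-1})$; 3. if $q\ne0$, then $\omega(F_n(\mathbf{z};q,t))=q^{\binom n2}F_n(\mathbf{z};q^{-1},t)$; and if $t\neq 0$, then $\omega(F_n(\mathbf{z};q,t))=t^{\binom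 n2}F_n(\mathbf{z};q,t^{-1})$. -/

import Mathlib

open Equiv (Perm)

noncomputable section

/-! ### Symmetric functions in the infinitely many variables `z₀, z₁, z₂, …` -/

/-- The ring `Λ_K` of symmetric functions: formal power series of bounded degree in countably many
variables over `K` that are invariant under all permutations of the variables. -/
def SymFun (K : Type*) [CommRing K] : Subalgebra K (MvPowerSeries ℕ K) where
  carrier := {f | (∀ e : Perm ℕ, MvPowerSeries.rename e f = f) ∧
    ∃ N : ℕ, ∀ d : ℕ →₀ ℕ, MvPowerSeries.coeff d f ≠ 0 → d.degree ≤ N}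
  mul_mem' := by
    rintro f g ⟨hf, N, hN⟩ ⟨hg, M, hM⟩
    refine ⟨fun e => by rw [map_mul, hf, hg], N + M, fun d hd => ?_⟩
    classical
    rw [MvPowerSeries.coeff_mul] at hd
    obtain ⟨p, hp, hne⟩ := Finset.exists_ne_zero_of_sum_ne_zero hd
    rw [← Finset.HasAntidiagonal.mem_antidiagonal.mp hp, map_add]
    exact add_le_add (hN _ (left_ne_zero_of_mul hne)) (hM _ (right_ne_zero_of_mul hne))
  add_mem' := by
    rintro f g ⟨hf, N, hN⟩ ⟨hg, M, hM⟩
    refine ⟨fun e => by rw [map_add, hf, hg], max N M, fun d hd => ?_⟩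
    rw [map_add] at hd
    by_cases h : MvPowerSeries.coeff d f = 0
    · rw [h, zero_add] at hd
      exact (hM d hd).trans (le_max_right _ _)
    · exact (hN d h).trans (le_max_left _ _)
  algebraMap_mem' := by
    intro r
    refine ⟨fun e => AlgHom.commutes _ r, 0, fun d hd => ?_⟩
    classical
    rw [MvPowerSeries.algebraMap_apply, MvPowerSeries.coeff_C] at hd
    by_cases h : d = 0
    · simp [h]
    · simp [h] at hd

/-- A power series whose coefficients are permutation invariant is fixed by renaming. -/
theorem rename_perm_eq_self {K : Type*} [CommRing K] (f : MvPowerSeries ℕ K)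
    (hf : ∀ (e : Perm ℕ) (d : ℕ →₀ ℕ),
      MvPowerSeries.coeff (d.mapDomain e) f = MvPowerSeries.coeff d f) (e : Perm ℕ) :
    MvPowerSeries.rename e f = f := by
  ext d
  obtain ⟨c, rfl⟩ : ∃ c : ℕ →₀ ℕ, c.mapDomain e = d := by
    refine ⟨d.mapDomain e.symm, ?_⟩
    rw [← Finsupp.mapDomain_comp]
    simp
  have h := MvPowerSeries.coeff_embDomain_rename e.toEmbedding f c
  rw [Finsupp.embDomain_eq_mapDomain] at h
  rw [hf]
  exact h

/-- The power series with given coefficients. -/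
def seriesOf {K : Type*} [CommRing K] (c : (ℕ →₀ ℕ) → K) : MvPowerSeries ℕ K := c

theorem coeff_seriesOf {K : Type*} [CommRing K] (c : (ℕ →₀ ℕ) → K) (d : ℕ →₀ ℕ) :
    MvPowerSeries.coeff d (seriesOf c) = c d := rfl

/-- The complete homogeneous symmetric function `h_k`, the sum of all monomials of degree `k`. -/
def hSym (K : Type*) [CommRing K] (k : ℕ) : SymFun K :=
  ⟨seriesOf fun d => if d.degree = k then 1 else 0, by
    refine ⟨rename_perm_eq_self _ fun e d => ?_, k, fun d hd => ?_⟩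
    · simp [coeff_seriesOf, Finsupp.degree_mapDomain]
    · by_contra hlt
      apply hd
      rw [coeff_seriesOf, if_neg (by omega)]⟩

open Classical in
/-- The power sum `p_k = z₀ ^ k + z₁ ^ k + z₂ ^ k + ⋯`; it is only used for `k ≥ 1`. -/
def pSym (K : Type*) [CommRing K] (k : ℕ) : SymFun K :=
  ⟨seriesOf fun d => if ∃ i : ℕ, d = Finsupp.single i k then 1 else 0, by
    refine ⟨rename_perm_eq_self _ fun e d => ?_, k, fun d hd => ?_⟩
    · rw [coeff_seriesOf, coeff_seriesOf]
      refine if_congr ⟨?_, ?_⟩ rfl rfl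
      · rintro ⟨i, hi⟩
        refine ⟨e.symm i, Finsupp.mapDomain_injective e.injective ?_⟩
        simpa using hi
      · rintro ⟨i, rfl⟩
        exact ⟨e i, by simp⟩
    · rw [coeff_seriesOf] at hd
      obtain ⟨i, rfl⟩ : ∃ i : ℕ, d = Finsupp.single i k := by
        by_contra h
        exact hd (if_neg h)
      simp⟩

/-- `p_λ = p_{λ₁} p_{λ₂} ⋯` for a partition `λ`. -/
def pSymPart (K : Type*) [CommRing K] {n : ℕ} (l : n.Partition) : SymFun K :=
  (l.parts.map (pSym K)).prod

/-- `h_k` for an integer index, with `h_k = 0` for `k < 0`. -/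
def hSymInt (K : Type*) [CommRing K] (k : ℤ) : SymFun K :=
  if k < 0 then 0 else hSym K k.toNat

/-- The Schur function `s_μ = det (h_{μ_i - i + j})`, `1 ≤ i, j ≤ ℓ(μ)`, of a partition `μ`
(a Young diagram with row lengths `μ_i`). -/
def schur (K : Type*) [CommRing K] (μ : YoungDiagram) : SymFun K :=
  Matrix.det (Matrix.of fun i j : Fin (μ.colLen 0) =>
    hSymInt K ((μ.rowLen i : ℤ) - (i : ℤ) + (j : ℤ)))

/-! ### Harmonic polynomials -/

/-- Partial derivatives commute. -/
theorem pderiv_commute {σ : Type*} (i j : σ) :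
    Commute ((MvPolynomial.pderiv i : Derivation ℂ (MvPolynomial σ ℂ) _).toLinearMap :
        Module.End ℂ (MvPolynomial σ ℂ))
      (MvPolynomial.pderiv j : Derivation ℂ (MvPolynomial σ ℂ) _).toLinearMap := by
  classical
  have h : ⁅(MvPolynomial.pderiv i : Derivation ℂ (MvPolynomial σ ℂ) _),
      (MvPolynomial.pderiv j : Derivation ℂ (MvPolynomial σ ℂ) _)⁆ = 0 := by
    refine MvPolynomial.derivation_ext fun k => ?_
    rw [Derivation.commutator_apply, MvPolynomial.pderiv_X, MvPolynomial.pderiv_X]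
    by_cases h1 : k = i <;> by_cases h2 : k = j <;> simp [Pi.single_apply, h1, h2] <;>
      split_ifs <;> simp
  refine LinearMap.ext fun p => ?_
  have h' := congrArg (fun D : Derivation ℂ (MvPolynomial σ ℂ) (MvPolynomial σ ℂ) => D p) h
  simpa [Derivation.commutator_apply, sub_eq_zero] using h'

open scoped IsMulCommutative in
/-- `P ↦ P(∂)`: the algebra homomorphism from polynomials to differential operators that replaces
each variable by the corresponding partial derivative. -/
def diffOp (σ : Type*) : MvPolynomial σ ℂ →ₐ[ℂ] Module.End ℂ (MvPolynomial σ ℂ) :=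
  let D : σ → Module.End ℂ (MvPolynomial σ ℂ) := fun i => (MvPolynomial.pderiv i).toLinearMap
  haveI : IsMulCommutative (Algebra.adjoin ℂ (Set.range D)) :=
    Algebra.isMulCommutative_adjoin ℂ (by
      rintro _ ⟨i, rfl⟩ _ ⟨j, rfl⟩
      exact pderiv_commute i j)
  (Algebra.adjoin ℂ (Set.range D)).val.comp
    (MvPolynomial.aeval fun i => ⟨D i, Algebra.subset_adjoin ⟨i, rfl⟩⟩)

theorem diffOp_X {σ : Type*} (i : σ) (p : MvPolynomial σ ℂ) :
    diffOp σ (MvPolynomial.X i) p = MvPolynomial.pderiv i p := by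
  simp [diffOp]

/-- The scalar product `⟨P, Q⟩ = P(∂) Q |₀` on polynomials. -/
def polyPairing (σ : Type*) : LinearMap.BilinForm ℂ (MvPolynomial σ ℂ) :=
  LinearMap.compr₂ (diffOp σ).toLinearMap (MvPolynomial.aeval (0 : σ → ℂ)).toLinearMap

theorem polyPairing_apply {σ : Type*} (P Q : MvPolynomial σ ℂ) :
    polyPairing σ P Q = MvPolynomial.aeval (0 : σ → ℂ) (diffOp σ P Q) := rfl

/-- The ring `ℂ[x, y]`, with `x_i = X (Sum.inl i)` and `y_i = X (Sum.inr i)` for `i : Fin n`. -/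
abbrev PolyXY (n : ℕ) : Type := MvPolynomial (Fin n ⊕ Fin n) ℂ

/-- The ideal generated by the `S_n × S_n`-invariant polynomials without constant term, where
`(σ, τ)` acts by `x_i ↦ x_{σ i}`, `y_i ↦ y_{τ i}`. -/
def invariantIdeal (n : ℕ) : Ideal (PolyXY n) :=
  Ideal.span {f | (∀ σ τ : Perm (Fin n), MvPolynomial.rename (Sum.map σ τ) f = f) ∧
    MvPolynomial.constantCoeff f = 0}

/-- The space of `S_n × S_n`-harmonic polynomials, the orthogonal complement of the ideal. -/
def harmonics (n : ℕ) : Submodule ℂ (PolyXY n) :=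
  (polyPairing (Fin n ⊕ Fin n)).orthogonal ((invariantIdeal n).restrictScalars ℂ)

/-- The diagonal action of `S_n` on `ℂ[x, y]`: `x_i ↦ x_{g i}`, `y_i ↦ y_{g i}`. -/
def diagonalRep (n : ℕ) : Representation ℂ (Perm (Fin n)) (PolyXY n) where
  toFun g := (MvPolynomial.rename (Sum.map g g)).toLinearMap
  map_one' := by
    refine LinearMap.ext fun p => ?_
    simp
  map_mul' g h := by
    refine LinearMap.ext fun p => ?_
    simp [MvPolynomial.rename_rename, Sum.map_comp_map]

theorem diagonalRep_apply {n : ℕ} (g : Perm (Fin n)) (p : PolyXY n) :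
    diagonalRep n g p = MvPolynomial.rename (Sum.map g g) p := rfl

theorem diffOp_rename {σ : Type*} (e : Perm σ) (P Q : MvPolynomial σ ℂ) :
    diffOp σ (MvPolynomial.rename e P) (MvPolynomial.rename e Q) =
      MvPolynomial.rename e (diffOp σ P Q) := by
  induction P using MvPolynomial.induction_on generalizing Q with
  | C a =>
    rw [MvPolynomial.rename_C, ← MvPolynomial.algebraMap_eq, AlgHom.commutes]
    simp [Module.algebraMap_end_apply]
  | add p q hp hq => simp [hp, hq]
  | mul_X p i hp =>
    rw [map_mul, map_mul, map_mul, MvPolynomial.rename_X, Module.End.mul_apply,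
      Module.End.mul_apply, diffOp_X, diffOp_X, MvPolynomial.pderiv_rename e.injective, hp]

/-- The harmonic polynomials as an `S_n`-submodule of `ℂ[x, y]` under the diagonal action. -/
def harmonicsRep (n : ℕ) : Subrepresentation (diagonalRep n) where
  toSubmodule := harmonics n
  apply_mem_toSubmodule g v hv := by
    intro P hP
    have hg : (Sum.map g g : Fin n ⊕ Fin n → Fin n ⊕ Fin n) = Equiv.sumCongr g g := rfl
    have hP' : MvPolynomial.rename (Equiv.sumCongr g g).symm P ∈ invariantIdeal n := by
      have hle : invariantIdeal n ≤ (invariantIdeal n).comap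
          (MvPolynomial.rename (R := ℂ) (Equiv.sumCongr g g).symm) := by
        refine Ideal.span_le.mpr ?_
        rintro f ⟨hf, hf0⟩
        have : MvPolynomial.rename (Equiv.sumCongr g g).symm f = f := hf g.symm g.symm
        rw [SetLike.mem_coe, Ideal.mem_comap]
        change MvPolynomial.rename (Equiv.sumCongr g g).symm f ∈ invariantIdeal n
        rw [this]
        exact Ideal.subset_span ⟨hf, hf0⟩
      exact hle hP
    have h0 := hv _ hP'
    rw [polyPairing_apply] at h0 ⊢
    rw [diagonalRep_apply, hg]
    have h1 : P = MvPolynomial.rename (Equiv.sumCongr g g)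
        (MvPolynomial.rename (Equiv.sumCongr g g).symm P) := by
      rw [MvPolynomial.rename_rename, Equiv.self_comp_symm, MvPolynomial.rename_id_apply]
    rw [h1, diffOp_rename, MvPolynomial.aeval_rename]
    exact h0

/-! ### The bigraded Frobenius characteristic -/

/-- The bidegree of the variables: `x_i` has bidegree `(1, 0)` and `y_i` has bidegree `(0, 1)`. -/
def bidegree (n : ℕ) : Fin n ⊕ Fin n → ℕ × ℕ :=
  Sum.elim (fun _ => (1, 0)) (fun _ => (0, 1))

theorem weightedHomogeneousComponent_diagonalRep {n : ℕ} (g : Perm (Fin n)) (d : ℕ × ℕ)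
    (p : PolyXY n) :
    MvPolynomial.weightedHomogeneousComponent (bidegree n) d (diagonalRep n g p) =
      diagonalRep n g (MvPolynomial.weightedHomogeneousComponent (bidegree n) d p) := by
  classical
  have hg : (Sum.map g g : Fin n ⊕ Fin n → Fin n ⊕ Fin n) = Equiv.sumCongr g g := rfl
  have hw : bidegree n ∘ Equiv.sumCongr g g = bidegree n := by
    funext i
    cases i <;> rfl
  rw [diagonalRep_apply, diagonalRep_apply, hg]
  ext m
  obtain ⟨c, rfl⟩ : ∃ c : Fin n ⊕ Fin n →₀ ℕ, c.mapDomain (Equiv.sumCongr g g) = m := by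
    refine ⟨m.mapDomain (Equiv.sumCongr g g).symm, ?_⟩
    rw [← Finsupp.mapDomain_comp, Equiv.self_comp_symm,
      Finsupp.mapDomain_id]
  have hwt : Finsupp.weight (bidegree n) (c.mapDomain (Equiv.sumCongr g g)) =
      Finsupp.weight (bidegree n) c := by
    rw [Finsupp.weight_apply, Finsupp.weight_apply,
      Finsupp.sum_mapDomain_index (by simp) (by intros; simp [add_smul])]
    exact Finsupp.sum_congr fun i _ => by rw [← congrFun hw i]; rfl
  rw [MvPolynomial.coeff_rename_mapDomain _ (Equiv.sumCongr g g).injective,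
    MvPolynomial.coeff_weightedHomogeneousComponent,
    MvPolynomial.coeff_weightedHomogeneousComponent, hwt,
    MvPolynomial.coeff_rename_mapDomain _ (Equiv.sumCongr g g).injective]

/-- The bihomogeneous component `V_{j,k} = π_{j,k}(V)` of an `S_n`-submodule `V` of `ℂ[x, y]`. -/
def bigradedPiece {n : ℕ} (V : Subrepresentation (diagonalRep n)) (d : ℕ × ℕ) :
    Subrepresentation (diagonalRep n) where
  toSubmodule :=
    V.toSubmodule.map (MvPolynomial.weightedHomogeneousComponent (bidegree n) d)
  apply_mem_toSubmodule g v hv := by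
    obtain ⟨p, hp, rfl⟩ := hv
    exact ⟨diagonalRep n g p, V.apply_mem_toSubmodule g hp,
      weightedHomogeneousComponent_diagonalRep g d p⟩

/-- The Frobenius characteristic `(1 / n!) ∑_σ χ_W(σ) p_{λ(σ)}` of an `S_n`-submodule `W` of
`ℂ[x, y]`, as a symmetric function over an extension field `K` of `ℂ`. -/
def frobeniusChar (K : Type*) [Field K] [Algebra ℂ K] {n : ℕ}
    (W : Subrepresentation (diagonalRep n)) : SymFun K :=
  (n.factorial : K)⁻¹ • ∑ g : Perm (Fin n),
    algebraMap ℂ K (W.toRepresentation.character g) • pSymPart K g.partition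

/-- The bigraded Frobenius characteristic `∑_{j,k} q ^ j t ^ k 𝓕(V_{j,k})` of an `S_n`-submodule
`V` of `ℂ[x, y]` that has only finitely many nonzero bihomogeneous components. -/
def bigradedFrobenius {K : Type*} [Field K] [Algebra ℂ K] {n : ℕ}
    (V : Subrepresentation (diagonalRep n)) (q t : K) : SymFun K :=
  ∑ᶠ d : ℕ × ℕ, (q ^ d.1 * t ^ d.2) • frobeniusChar K (bigradedPiece V d)

/-- `F_n(z; q, t)`, the bigraded Frobenius characteristic of the `S_n × S_n`-harmonics. The
parameters `q, t` are arbitrary elements of an extension field `K` of `ℂ`; they are independent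
indeterminates when `K = ℂ(q, t)`. -/
def frobF {K : Type*} [Field K] [Algebra ℂ K] (n : ℕ) (q t : K) : SymFun K :=
  bigradedFrobenius (harmonicsRep n) q t

end

open Equiv (Perm)
open Finset.HasAntidiagonal (antidiagonal mem_antidiagonal)

noncomputable section


/-! The heart is the flip f(x, y) ↦ f(∂x, y) Δ(x), with Δ the Vandermonde determinant. It sends
bidegree (j, k) to (binom(n,2) - j, k) and commutes with the diagonal action up to the sign
character. Once it is known to restrict to bijections between the pieces of 𝓗, the characters
satisfy χ_{binom(n,2)-j, k} = sgn · χ_{j,k} (`character_bigradedPiece_flip`). As ω multiplies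
p_{λ(σ)} by sgn(σ) (`omegaHom_pSymPart`), this is the q-half of claim 3. Exchanging x and y
preserves 𝓗, which gives claim 1 and the t-half of claim 3; claim 2 then follows from the two halves
and ω² = 1.

The flip preserves 𝓗 because it is self-adjoint for the scalar product (`polyPairing_flipX`) and
preserves 𝓘 (`flipX_mem_invariantIdeal`). The latter rests on Q(∂x, y)Δ = Q(0, y)Δ for Q symmetric
in x: the difference is alternating in x, and its degree in x is too small for a nonzero alternating
polynomial. The flip is injective on each piece because its kernel lies in 𝓘
(`mem_invariantIdeal_of_flipX_eq_zero`, by Artin's monomials for the coinvariants of ℂ[x]), while 𝓘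
meets the pieces of 𝓗 only in 0, by positivity of the scalar product.

On the side of symmetric functions, ω is built as the algebra map e_k ↦ h_k, which is possible
because the e_k generate Λ freely. The dual Jacobi–Trudi identity shows that it conjugates Schur
functions, and since these span Λ (`span_range_schur`) it is the only such linear map. Its values on
power sums come from Newton's identity. -/

/-! ### Elementary symmetric functions and Newton's identities -/

/-- The elementary symmetric function `e_k`, the sum of all squarefree monomials of degree `k`. -/
def eSym (K : Type*) [CommRing K] (k : ℕ) : SymFun K :=
  ⟨seriesOf fun d => if d.degree = k then (if ∀ i ∈ d.support, d i = 1 then 1 else 0) else 0, by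
    refine ⟨rename_perm_eq_self _ fun e d => ?_, k, fun d hd => ?_⟩
    · classical
      simp only [coeff_seriesOf, Finsupp.degree_mapDomain,
        Finsupp.mapDomain_support_of_injective e.injective, Finset.mem_image,
        forall_exists_index, and_imp, forall_apply_eq_imp_iff₂,
        Finsupp.mapDomain_apply e.injective]
    · by_contra hlt
      apply hd
      rw [coeff_seriesOf, if_neg (by omega)]⟩

section Identities

variable {K : Type*} [CommRing K]

theorem SymFun.coe_sum {ι : Type*} (s : Finset ι) (f : ι → SymFun K) :
    ((∑ i ∈ s, f i : SymFun K) : MvPowerSeries ℕ K) = ∑ i ∈ s, (f i : MvPowerSeries ℕ K) :=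
  map_sum (SymFun K).val f s

/-- Summing products of homogeneous parts of two power series over complementary degrees. -/
theorem coeff_sum_antidiagonal_seriesOf (φ ψ : (ℕ →₀ ℕ) → K) (n : ℕ) (d : ℕ →₀ ℕ) :
    MvPowerSeries.coeff d (∑ p ∈ antidiagonal n,
      seriesOf (fun a => if a.degree = p.1 then φ a else 0) *
        seriesOf (fun b => if b.degree = p.2 then ψ b else 0)) =
      if d.degree = n then ∑ p ∈ antidiagonal d, φ p.1 * ψ p.2 else 0 := by
  classical
  simp only [map_sum, MvPowerSeries.coeff_mul, coeff_seriesOf]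
  rw [Finset.sum_comm]
  have key : ∀ p ∈ antidiagonal d, ∑ x ∈ antidiagonal n,
      (if p.1.degree = x.1 then φ p.1 else 0) * (if p.2.degree = x.2 then ψ p.2 else 0) =
      if d.degree = n then φ p.1 * ψ p.2 else 0 := by
    intro p hp
    have hd : d.degree = p.1.degree + p.2.degree := by
      rw [← mem_antidiagonal.mp hp, map_add]
    split_ifs with h
    · rw [Finset.sum_eq_single (p.1.degree, p.2.degree)]
      · simp
      · rintro ⟨x, y⟩ - hne
        by_cases h1 : p.1.degree = x
        · by_cases h2 : p.2.degree = y
          · exact absurd (by rw [h1, h2]) hne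
          · simp [h2]
        · simp [h1]
      · intro hx
        exact absurd (mem_antidiagonal.mpr (by rw [← hd, h])) hx
    · refine Finset.sum_eq_zero ?_
      rintro ⟨x, y⟩ hx
      have hx := mem_antidiagonal.mp hx
      by_cases h1 : p.1.degree = x
      · by_cases h2 : p.2.degree = y
        · simp only at hx; omega
        · simp [h2]
      · simp [h1]
  rw [Finset.sum_congr rfl key]
  split_ifs <;> simp

theorem eSym_zero : eSym K 0 = 1 := by
  classical
  apply Subtype.ext
  ext d
  change (if d.degree = 0 then _ else _) = MvPowerSeries.coeff d 1
  rw [MvPowerSeries.coeff_one]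
  by_cases h : d = 0
  · simp [h]
  · rw [if_neg h, if_neg (by rwa [Finsupp.degree_eq_zero_iff])]

theorem hSym_zero : hSym K 0 = 1 := by
  classical
  apply Subtype.ext
  ext d
  change (if d.degree = 0 then _ else _) = MvPowerSeries.coeff d 1
  rw [MvPowerSeries.coeff_one]
  by_cases h : d = 0
  · simp [h]
  · rw [if_neg h, if_neg (by rwa [Finsupp.degree_eq_zero_iff])]

/-- The coefficient at a monomial of degree n is a signed count of its squarefree divisors, that is,
of the subsets of its support; this alternating sum vanishes unless the support is empty. -/
theorem sum_antidiagonal_eSym_mul_hSym (n : ℕ) :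
    ∑ p ∈ antidiagonal n, (-1) ^ p.1 * eSym K p.1 * hSym K p.2 = if n = 0 then 1 else 0 := by
  classical
  apply Subtype.ext
  ext d
  have h := coeff_sum_antidiagonal_seriesOf (K := K)
    (fun a => (-1) ^ a.degree * if ∀ i ∈ a.support, a i = 1 then 1 else 0) (fun _ => 1) n d
  have h2 : ((∑ p ∈ antidiagonal n, (-1) ^ p.1 * eSym K p.1 * hSym K p.2 : SymFun K) :
      MvPowerSeries ℕ K) = ∑ p ∈ antidiagonal n,
      seriesOf (fun a => if a.degree = p.1 then
        (-1) ^ a.degree * (if ∀ i ∈ a.support, a i = 1 then 1 else 0) else 0) *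
        seriesOf (fun b => if b.degree = p.2 then (1 : K) else 0) := by
    rw [SymFun.coe_sum]
    refine Finset.sum_congr rfl fun p _ => ?_
    rw [MulMemClass.coe_mul, MulMemClass.coe_mul]
    congr 1
    ext a
    have : ((((-1) ^ p.1 : SymFun K)) : MvPowerSeries ℕ K) = MvPowerSeries.C ((-1) ^ p.1) := by
      simp
    rw [this, MvPowerSeries.coeff_C_mul, eSym, coeff_seriesOf, coeff_seriesOf]
    split_ifs with h1 <;> simp [h1]
  rw [h2, h]
  have h3 : ∑ p ∈ antidiagonal d,
      ((-1 : K) ^ p.1.degree * if ∀ i ∈ p.1.support, p.1 i = 1 then 1 else 0) * 1 =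
      ∑ s ∈ d.support.powerset, (-1 : K) ^ s.card := by
    simp only [mul_one, mul_ite, mul_zero]
    rw [← Finset.sum_filter]
    refine Finset.sum_nbij' (fun p => p.1.support)
      (fun s => (Finsupp.indicator s fun _ _ => 1, d - Finsupp.indicator s fun _ _ => 1))
      ?_ ?_ ?_ ?_ ?_
    · rintro ⟨a, b⟩ hab
      simp only [Finset.mem_filter, mem_antidiagonal] at hab
      rw [Finset.mem_powerset, ← hab.1]
      exact Finsupp.support_mono le_self_add
    · intro s hs
      rw [Finset.mem_powerset] at hs
      simp only [Finset.mem_filter, mem_antidiagonal]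
      refine ⟨add_tsub_cancel_of_le fun i => ?_, fun i hi => ?_⟩
      · rw [Finsupp.indicator_apply]
        split_ifs with his
        · exact Nat.one_le_iff_ne_zero.mpr (Finsupp.mem_support_iff.mp (hs his))
        · exact Nat.zero_le _
      · have := Finsupp.support_indicator_subset _ _ hi
        rw [Finsupp.indicator_apply, dif_pos this]
    · rintro ⟨a, b⟩ hab
      simp only [Finset.mem_filter, mem_antidiagonal] at hab
      have ha : (Finsupp.indicator a.support fun _ _ => 1) = a := by
        ext i
        rw [Finsupp.indicator_apply]
        split_ifs with hi
        · exact (hab.2 i hi).symm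
        · exact (Finsupp.notMem_support_iff.mp hi).symm
      simp only [ha, Prod.mk.injEq, true_and]
      rw [← hab.1, add_tsub_cancel_left]
    · intro s hs
      ext i
      simp [Finsupp.indicator_apply]
    · rintro ⟨a, b⟩ hab
      simp only [Finset.mem_filter, mem_antidiagonal] at hab
      congr 1
      rw [Finsupp.degree_apply, Finset.sum_congr rfl hab.2]
      simp
  rw [h3]
  have h4 : ∑ s ∈ d.support.powerset, (-1 : K) ^ s.card = if d = 0 then 1 else 0 := by
    have := congrArg (Int.cast : ℤ → K) (Finset.sum_powerset_neg_one_pow_card (x := d.support))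
    push_cast at this
    rw [this]
    simp
  rw [h4]
  by_cases hd : d = 0
  · subst hd
    by_cases hn : n = 0
    · simp [hn]
    · simp [hn, Ne.symm hn]
  · have : MvPowerSeries.coeff d (((if n = 0 then 1 else 0 : SymFun K)) : MvPowerSeries ℕ K) = 0 := by
      split_ifs
      · rw [OneMemClass.coe_one, MvPowerSeries.coeff_one, if_neg hd]
      · simp
    rw [this, if_neg hd]
    simp

/-- A monomial z^d of degree n + 1 has exactly d_i divisors z_i^k with k ≥ 1 for each i, hence n + 1
nontrivial pure power divisors in all. -/
theorem sum_antidiagonal_pSym_mul_hSym (n : ℕ) :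
    ∑ p ∈ antidiagonal n, pSym K (p.1 + 1) * hSym K p.2 = (n + 1 : ℕ) * hSym K (n + 1) := by
  classical
  apply Subtype.ext
  ext d
  have h := coeff_sum_antidiagonal_seriesOf (K := K)
    (fun a => if a ≠ 0 ∧ ∃ i, a = Finsupp.single i a.degree then 1 else 0) (fun _ => 1) (n + 1) d
  have h2 : ((∑ p ∈ antidiagonal n, pSym K (p.1 + 1) * hSym K p.2 : SymFun K) :
      MvPowerSeries ℕ K) = ∑ p ∈ antidiagonal (n + 1),
      seriesOf (fun a => if a.degree = p.1 then
        (if a ≠ 0 ∧ ∃ i, a = Finsupp.single i a.degree then 1 else 0) else 0) *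
        seriesOf (fun b => if b.degree = p.2 then (1 : K) else 0) := by
    rw [SymFun.coe_sum, Finset.Nat.antidiagonal_succ, Finset.sum_cons, Finset.sum_map]
    have h0 : seriesOf (fun a : ℕ →₀ ℕ => if a.degree = 0 then
        (if a ≠ 0 ∧ ∃ i, a = Finsupp.single i a.degree then (1 : K) else 0) else 0) = 0 := by
      ext a
      rw [coeff_seriesOf]
      by_cases ha : a = 0 <;> simp [ha, Finsupp.degree_eq_zero_iff]
    rw [h0, zero_mul, zero_add]
    refine Finset.sum_congr rfl fun p _ => ?_
    rw [MulMemClass.coe_mul]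
    congr 1
    ext a
    rw [pSym, coeff_seriesOf, coeff_seriesOf]
    by_cases ha : ∃ i, a = Finsupp.single i (p.1 + 1)
    · obtain ⟨i, rfl⟩ := ha
      rw [if_pos ⟨i, rfl⟩, Finsupp.degree_single]
      change 1 = if p.1 + 1 = p.1 + 1 then _ else _
      rw [if_pos rfl, if_pos ⟨by simp, i, rfl⟩]
    · rw [if_neg ha]
      split_ifs with h1 h2
      · exact absurd (by simpa [h1] using h2.2) ha
      · rfl
      · rfl
  rw [h2, h]
  have h3 : ∑ p ∈ antidiagonal d,
      (if p.1 ≠ 0 ∧ ∃ i, p.1 = Finsupp.single i p.1.degree then (1 : K) else 0) * 1 =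
      (d.degree : K) := by
    simp only [mul_one]
    rw [← Finset.sum_filter, Finset.sum_const, nsmul_eq_mul, mul_one]
    congr 1
    have hc : d.degree = (d.support.sigma fun i => Finset.range (d i)).card := by
      rw [Finset.card_sigma, Finsupp.degree_apply]
      simp
    rw [hc]
    symm
    refine Finset.card_bij (fun x _ => (Finsupp.single x.1 (x.2 + 1),
      d - Finsupp.single x.1 (x.2 + 1))) ?_ ?_ ?_
    · rintro ⟨i, k⟩ hx
      simp only [Finset.mem_sigma, Finset.mem_range] at hx
      simp only [Finset.mem_filter, mem_antidiagonal]
      refine ⟨add_tsub_cancel_of_le ?_, by simp, i, by simp⟩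
      rw [Finsupp.single_le_iff]
      exact hx.2
    · rintro ⟨i, k⟩ _ ⟨j, l⟩ _ hxy
      simp only [Prod.mk.injEq] at hxy
      obtain ⟨h5, h6⟩ | ⟨h5, h6⟩ := (Finsupp.single_eq_single_iff _ _ _ _).mp hxy.1
      · obtain rfl := h5
        obtain rfl : k = l := by omega
        rfl
      · omega
    · rintro ⟨a, b⟩ hab
      simp only [Finset.mem_filter, mem_antidiagonal] at hab
      obtain ⟨hab, ha0, i, hi⟩ := hab
      have hdeg : a.degree ≠ 0 := fun h0 => ha0 (by rw [hi, h0, Finsupp.single_zero])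
      have hle : a.degree ≤ d i := by
        have : a i ≤ d i := by rw [← hab]; simp
        rwa [hi, Finsupp.single_eq_same] at this
      refine ⟨⟨i, a.degree - 1⟩, ?_, ?_⟩
      · simp only [Finset.mem_sigma, Finset.mem_range, Finsupp.mem_support_iff]
        omega
      · have : a.degree - 1 + 1 = a.degree := by omega
        simp only [this, ← hi]
        rw [← hab, add_tsub_cancel_left]
  rw [h3]
  have h4 : ((((n + 1 : ℕ) * hSym K (n + 1) : SymFun K)) : MvPowerSeries ℕ K) =
      MvPowerSeries.C ((n + 1 : ℕ) : K) * seriesOf (fun d => if d.degree = n + 1 then 1 else 0) := by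
    rw [map_natCast, MulMemClass.coe_mul, hSym]
    simp
  rw [h4, MvPowerSeries.coeff_C_mul, coeff_seriesOf]
  split_ifs with hd <;> simp [hd]

end Identities


/-! ### The elementary symmetric functions freely generate the ring of symmetric functions -/

section Generation

variable {K : Type*} [CommRing K]

theorem SymFun.coeff_mapDomain (f : SymFun K) (e : Perm ℕ) (d : ℕ →₀ ℕ) :
    MvPowerSeries.coeff (d.mapDomain e) f.1 = MvPowerSeries.coeff d f.1 := by
  have h := MvPowerSeries.coeff_embDomain_rename e.toEmbedding f.1 d
  rw [Finsupp.embDomain_eq_mapDomain] at h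
  have h2 : MvPowerSeries.rename (e.toEmbedding : ℕ → ℕ) f.1 = f.1 := f.2.1 e
  rw [h2] at h
  exact h

/-- Setting the variables `z_i`, `i ≥ n`, to zero. -/
def SymFun.restrictVars (K : Type*) [CommRing K] (n : ℕ) :
    SymFun K →ₐ[K] MvPowerSeries (Fin n) K :=
  (MvPowerSeries.killCompl Fin.valEmbedding).comp (SymFun K).val

theorem SymFun.coeff_restrictVars (n : ℕ) (f : SymFun K) (d : Fin n →₀ ℕ) :
    MvPowerSeries.coeff d (SymFun.restrictVars K n f) =
      MvPowerSeries.coeff (d.embDomain Fin.valEmbedding) f.1 :=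
  MvPowerSeries.coeff_killCompl _ _

theorem Finsupp.degree_embDomain' {α β : Type*} (e : α ↪ β) (d : α →₀ ℕ) :
    (d.embDomain e).degree = d.degree := by
  rw [Finsupp.embDomain_eq_mapDomain, Finsupp.degree_mapDomain]

theorem MvPolynomial.coeff_esymm {σ : Type*} [Fintype σ] (k : ℕ) (d : σ →₀ ℕ) :
    MvPolynomial.coeff d (MvPolynomial.esymm σ K k) =
      if d.degree = k then (if ∀ i ∈ d.support, d i = 1 then 1 else 0) else 0 := by
  classical
  have hsum : ∀ (t : Finset σ) (i : σ), (∑ j ∈ t, Finsupp.single j 1 : σ →₀ ℕ) i =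
      if i ∈ t then 1 else 0 := by
    intro t i
    rw [Finsupp.finsetSum_apply]
    simp [Finsupp.single_apply]
  have hsq : (∀ i ∈ d.support, d i = 1) → d.degree = d.support.card := by
    intro h
    rw [Finsupp.degree_apply, Finset.sum_congr rfl h]
    simp
  rw [MvPolynomial.esymm_eq_sum_monomial, MvPolynomial.coeff_sum]
  simp only [MvPolynomial.coeff_monomial]
  by_cases h : d.degree = k ∧ ∀ i ∈ d.support, d i = 1
  · rw [if_pos h.1, if_pos h.2, Finset.sum_eq_single d.support]
    · rw [if_pos]
      ext i
      rw [hsum]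
      split_ifs with hi
      · exact (h.2 i hi).symm
      · exact (Finsupp.notMem_support_iff.mp hi).symm
    · intro t _ hne
      rw [if_neg]
      rintro rfl
      apply hne
      ext i
      rw [Finsupp.mem_support_iff, hsum]
      simp
    · intro hn
      exact absurd (Finset.mem_powersetCard.mpr ⟨Finset.subset_univ _, by
        rw [← hsq h.2, h.1]⟩) hn
  · trans (0 : K)
    swap
    · split_ifs with h1 h2
      · exact absurd ⟨h1, h2⟩ h
      · rfl
      · rfl
    refine Finset.sum_eq_zero fun t ht => if_neg ?_
    rintro rfl
    have h2 : ∀ i ∈ (∑ j ∈ t, Finsupp.single j 1 : σ →₀ ℕ).support,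
        (∑ j ∈ t, Finsupp.single j 1 : σ →₀ ℕ) i = 1 := by
      intro i hi
      rw [Finsupp.mem_support_iff, hsum] at hi
      rw [hsum]
      split_ifs with h3
      · rfl
      · simp [h3] at hi
    refine h ⟨?_, h2⟩
    rw [map_sum]
    simpa using (Finset.mem_powersetCard.mp ht).2

theorem SymFun.restrictVars_eSym (n k : ℕ) :
    SymFun.restrictVars K n (eSym K k) = (MvPolynomial.esymm (Fin n) K k : MvPowerSeries (Fin n) K) := by
  ext d
  rw [SymFun.coeff_restrictVars, MvPolynomial.coeff_coe, MvPolynomial.coeff_esymm, eSym,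
    coeff_seriesOf, Finsupp.degree_embDomain']
  simp only [Finsupp.support_embDomain, Finset.mem_map, forall_exists_index, and_imp,
    forall_apply_eq_imp_iff₂, Finsupp.embDomain_apply_self]
  congr

theorem SymFun.restrictVars_aeval_eSym (n : ℕ) (f : MvPolynomial (Fin n) K) :
    SymFun.restrictVars K n (MvPolynomial.aeval (fun i : Fin n => eSym K (i + 1)) f) =
      ((MvPolynomial.esymmAlgHom (Fin n) K n f : MvPolynomial (Fin n) K) :
        MvPowerSeries (Fin n) K) := by
  have h : (SymFun.restrictVars K n).comp
        (MvPolynomial.aeval (fun i : Fin n => eSym K (i + 1))) =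
      (MvPolynomial.coeToMvPowerSeries.algHom K).comp
        ((MvPolynomial.symmetricSubalgebra (Fin n) K).val.comp
          (MvPolynomial.esymmAlgHom (Fin n) K n)) := by
    refine MvPolynomial.algHom_ext fun i => ?_
    simp [SymFun.restrictVars_eSym, MvPolynomial.esymmAlgHom]
  simpa using DFunLike.congr_fun h f

/-- The algebra homomorphism from polynomials sending the variables to `e₁, e₂, e₃, …`. -/
def eSymHom (K : Type*) [CommRing K] : MvPolynomial ℕ K →ₐ[K] SymFun K :=
  MvPolynomial.aeval fun i => eSym K (i + 1)

/-- A relation involves only finitely many e_1, …, e_n. Restricted to n variables it is a relation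
between elementary symmetric polynomials, which are algebraically independent. -/
theorem eSymHom_injective : Function.Injective (eSymHom K) := by
  rw [injective_iff_map_eq_zero]
  intro f hf
  obtain ⟨n, hn⟩ : ∃ n, ∀ i ∈ f.vars, i < n :=
    ⟨f.vars.sup id + 1, fun i hi => Nat.lt_succ_of_le (Finset.le_sup (f := id) hi)⟩
  obtain ⟨g, rfl⟩ := MvPolynomial.exists_rename_eq_of_vars_subset_range f
    (Fin.val : Fin n → ℕ) Fin.val_injective fun i hi => ⟨⟨i, hn i hi⟩, rfl⟩
  rw [eSymHom, MvPolynomial.aeval_rename] at hf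
  have h := SymFun.restrictVars_aeval_eSym n g
  change MvPolynomial.aeval (fun i : Fin n => eSym K (i + 1)) g = 0 at hf
  rw [hf, map_zero] at h
  have h2 : (MvPolynomial.esymmAlgHom (Fin n) K n g : MvPolynomial (Fin n) K) = 0 :=
    MvPolynomial.coe_injective _ _ (by rw [← h, MvPolynomial.coe_zero])
  have h3 : MvPolynomial.esymmAlgHom (Fin n) K n g = 0 := Subtype.ext h2
  rw [MvPolynomial.esymmAlgHom_fin_injective K le_rfl (h3.trans (map_zero _).symm), map_zero]

/-- Homogeneity of the products of elementary symmetric functions. -/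
theorem degree_eq_of_coeff_prod_eSym_ne_zero {n : ℕ} (m : Fin n →₀ ℕ) (d : ℕ →₀ ℕ)
    (hd : MvPowerSeries.coeff d
      (m.prod fun i k => eSym K (i + 1) ^ k : SymFun K).1 ≠ 0) :
    d.degree = m.sum fun i k => k * (i + 1) := by
  classical
  have hmul : ∀ (f g : SymFun K) (a b : ℕ), (∀ d, MvPowerSeries.coeff d f.1 ≠ 0 → d.degree = a) →
      (∀ d, MvPowerSeries.coeff d g.1 ≠ 0 → d.degree = b) →
      ∀ d, MvPowerSeries.coeff d (f * g : SymFun K).1 ≠ 0 → d.degree = a + b := by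
    intro f g a b hf hg d hd
    rw [MulMemClass.coe_mul, MvPowerSeries.coeff_mul] at hd
    obtain ⟨p, hp, hne⟩ := Finset.exists_ne_zero_of_sum_ne_zero hd
    rw [← mem_antidiagonal.mp hp, map_add, hf _ (left_ne_zero_of_mul hne),
      hg _ (right_ne_zero_of_mul hne)]
  have hone : ∀ d, MvPowerSeries.coeff d (1 : SymFun K).1 ≠ 0 → d.degree = 0 := by
    intro d hd
    rw [OneMemClass.coe_one, MvPowerSeries.coeff_one] at hd
    split_ifs at hd with h
    · simp [h]
    · exact absurd rfl hd
  have hpow : ∀ (i k : ℕ) d, MvPowerSeries.coeff d (eSym K i ^ k : SymFun K).1 ≠ 0 →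
      d.degree = k * i := by
    intro i k
    induction k with
    | zero => simpa using hone
    | succ k ih =>
      rw [pow_succ, Nat.succ_mul]
      refine hmul _ _ _ _ ih fun d hd => ?_
      rw [eSym, coeff_seriesOf] at hd
      by_contra h
      exact hd (if_neg h)
  rw [Finsupp.prod] at hd
  rw [Finsupp.sum]
  revert d
  induction m.support using Finset.induction_on with
  | empty => simpa using hone
  | insert i s hi ih =>
    rw [Finset.prod_insert hi, Finset.sum_insert hi]
    exact hmul _ _ _ _ (hpow _ _) ih

/-- If g has degree at most n, the fundamental theorem in n variables writes its restriction as a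
polynomial in e_1, …, e_n. The same polynomial lifts to Λ and recovers g, because a monomial of
degree at most n has at most n variables and can be permuted into the first n. -/
theorem eSymHom_surjective : Function.Surjective (eSymHom K) := by
  classical
  intro g
  obtain ⟨n, hn⟩ := g.2.2
  have hfin : (Function.support fun d : Fin n →₀ ℕ =>
      MvPowerSeries.coeff (d.embDomain Fin.valEmbedding) g.1).Finite := by
    refine (Set.finite_Iic (Finsupp.equivFunOnFinite.symm fun _ : Fin n => n)).subset ?_
    intro d hd i
    have h := hn _ hd
    rw [Finsupp.degree_embDomain'] at h
    exact (Finsupp.le_degree i d).trans h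
  let G : MvPolynomial (Fin n) K := ∑ d ∈ hfin.toFinset,
    MvPolynomial.monomial d (MvPowerSeries.coeff (d.embDomain Fin.valEmbedding) g.1)
  have hG : ∀ d, MvPolynomial.coeff d G =
      MvPowerSeries.coeff (d.embDomain Fin.valEmbedding) g.1 := by
    intro d
    rw [MvPolynomial.coeff_sum]
    simp only [MvPolynomial.coeff_monomial]
    rw [Finset.sum_ite_eq']
    split_ifs with h
    · rfl
    · by_contra hne
      exact h (hfin.mem_toFinset.mpr (Ne.symm hne))
  have hsym : G.IsSymmetric := by
    intro e
    ext d
    obtain ⟨c, rfl⟩ : ∃ c : Fin n →₀ ℕ, c.mapDomain e = d := by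
      refine ⟨d.mapDomain e.symm, ?_⟩
      rw [← Finsupp.mapDomain_comp]
      simp
    rw [MvPolynomial.coeff_rename_mapDomain _ e.injective, hG, hG]
    let e' : Perm ℕ := e.viaFintypeEmbedding Fin.valEmbedding
    rw [← SymFun.coeff_mapDomain g e']
    congr 2
    simp only [Finsupp.embDomain_eq_mapDomain, ← Finsupp.mapDomain_comp]
    congr 1
    funext i
    exact Equiv.Perm.viaFintypeEmbedding_apply_image e Fin.valEmbedding i
  obtain ⟨F, hF⟩ := MvPolynomial.esymmAlgHom_fin_surjective K (le_refl n) ⟨G, hsym⟩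
  let wt : (Fin n →₀ ℕ) → ℕ := fun m => m.sum fun i k => k * (i + 1)
  -- Dropping the terms of weight above n makes the lift vanish in degrees above n, as g does, and
  -- changes nothing in degrees up to n.
  let F' : MvPolynomial (Fin n) K :=
    ∑ m ∈ F.support with wt m ≤ n, MvPolynomial.monomial m (F.coeff m)
  have hmon : ∀ m : Fin n →₀ ℕ, ∀ c : K, ∀ d,
      MvPowerSeries.coeff d (MvPolynomial.aeval (fun i : Fin n => eSym K (i + 1))
        (MvPolynomial.monomial m c) : SymFun K).1 =
      c * MvPowerSeries.coeff d (m.prod fun i k => eSym K (i + 1) ^ k : SymFun K).1 := by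
    intro m c d
    rw [MvPolynomial.aeval_monomial, ← Algebra.smul_def]
    rfl
  have hlow : ∀ d : ℕ →₀ ℕ, d.degree ≤ n →
      MvPowerSeries.coeff d (MvPolynomial.aeval (fun i : Fin n => eSym K (i + 1)) F').1 =
      MvPowerSeries.coeff d (MvPolynomial.aeval (fun i : Fin n => eSym K (i + 1)) F).1 := by
    intro d hd
    conv_rhs => rw [F.as_sum]
    rw [map_sum, map_sum, SymFun.coe_sum, SymFun.coe_sum, map_sum, map_sum]
    refine Finset.sum_subset (Finset.filter_subset _ _) fun m hm hm2 => ?_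
    rw [hmon]
    by_contra hne
    have := degree_eq_of_coeff_prod_eSym_ne_zero m d (right_ne_zero_of_mul hne)
    exact hm2 (Finset.mem_filter.mpr ⟨hm, this.symm.trans_le hd⟩)
  have hhigh : ∀ d : ℕ →₀ ℕ, n < d.degree →
      MvPowerSeries.coeff d (MvPolynomial.aeval (fun i : Fin n => eSym K (i + 1)) F').1 = 0 := by
    intro d hd
    rw [map_sum, SymFun.coe_sum, map_sum]
    refine Finset.sum_eq_zero fun m hm => ?_
    rw [hmon]
    by_contra hne
    have := degree_eq_of_coeff_prod_eSym_ne_zero m d (right_ne_zero_of_mul hne)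
    have h2 := (Finset.mem_filter.mp hm).2
    simp only [wt] at h2
    omega
  refine ⟨MvPolynomial.rename Fin.val F', ?_⟩
  rw [eSymHom, MvPolynomial.aeval_rename]
  change MvPolynomial.aeval (fun i : Fin n => eSym K (i + 1)) F' = g
  apply Subtype.ext
  ext d
  by_cases hd : n < d.degree
  · rw [hhigh d hd]
    by_contra hne
    exact absurd (hn d (Ne.symm hne)) (by omega)
  · rw [not_lt] at hd
    rw [hlow d hd]
    have hcard : d.support.card ≤ n := by
      refine le_trans ?_ hd
      rw [Finsupp.degree_apply, Finset.card_eq_sum_ones]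
      exact Finset.sum_le_sum fun i hi => Nat.one_le_iff_ne_zero.mpr (Finsupp.mem_support_iff.mp hi)
    obtain ⟨e, he⟩ : ∃ e : Perm ℕ, ∀ i ∈ d.support, e i < n := by
      have := Equiv.Perm.isMultiplyPretransitive ℕ d.support.card
      obtain ⟨e, he⟩ := MulAction.exists_smul_eq (Perm ℕ)
        (d.support.equivFin.symm.toEmbedding.trans (Function.Embedding.subtype _))
        (Fin.valEmbedding : Fin d.support.card ↪ ℕ)
      refine ⟨e, fun i hi => ?_⟩
      have h := DFunLike.congr_fun he (d.support.equivFin ⟨i, hi⟩)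
      have h2 : e i = (d.support.equivFin ⟨i, hi⟩ : Fin _) := by simpa using h
      rw [h2]
      exact (Fin.is_lt _).trans_le hcard
    obtain ⟨c, hc⟩ : d.mapDomain e ∈ Set.range (Finsupp.embDomain (Fin.valEmbedding (n := n))) := by
      rw [Finsupp.mem_range_embDomain_iff, Finsupp.mapDomain_support_of_injective e.injective]
      intro i hi
      obtain ⟨j, hj, rfl⟩ := Finset.mem_image.mp hi
      exact ⟨⟨e j, he j hj⟩, rfl⟩
    have h := congrArg (MvPowerSeries.coeff c) (SymFun.restrictVars_aeval_eSym n F)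
    rw [hF, MvPolynomial.coeff_coe, hG, SymFun.coeff_restrictVars, hc,
      SymFun.coeff_mapDomain, SymFun.coeff_mapDomain] at h
    exact h

end Generation


/-! ### The involution `ω` -/

section Omega

variable {K : Type*} [CommRing K]

/-- The algebra endomorphism `ω` of the ring of symmetric functions with `ω(e_k) = h_k`. -/
def omegaHom (K : Type*) [CommRing K] : SymFun K →ₐ[K] SymFun K :=
  (MvPolynomial.aeval fun i => hSym K (i + 1)).comp
    (AlgEquiv.ofBijective (eSymHom K) ⟨eSymHom_injective, eSymHom_surjective⟩).symm.toAlgHom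

theorem omegaHom_eSym (k : ℕ) : omegaHom K (eSym K k) = hSym K k := by
  cases k with
  | zero => rw [eSym_zero, hSym_zero, map_one]
  | succ k =>
    have h : (AlgEquiv.ofBijective (eSymHom K) ⟨eSymHom_injective, eSymHom_surjective⟩).symm
        (eSym K (k + 1)) = MvPolynomial.X k := by
      rw [AlgEquiv.symm_apply_eq]
      simp [eSymHom]
    simp [omegaHom, h]

theorem evalNegHom_mk {A : Type*} [CommRing A] (f : ℕ → A) :
    PowerSeries.evalNegHom (PowerSeries.mk f) = PowerSeries.mk fun k => (-1) ^ k * f k := by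
  ext k
  simp [PowerSeries.evalNegHom, PowerSeries.coeff_rescale]

theorem evalNegHom_evalNegHom {A : Type*} [CommRing A] (f : PowerSeries A) :
    PowerSeries.evalNegHom (PowerSeries.evalNegHom f) = f := by
  ext k
  simp [PowerSeries.evalNegHom, PowerSeries.coeff_rescale, ← mul_assoc, ← mul_pow]

theorem derivative_evalNegHom {A : Type*} [CommRing A] (f : PowerSeries A) :
    PowerSeries.derivative A (PowerSeries.evalNegHom f) =
      -PowerSeries.evalNegHom (PowerSeries.derivative A f) := by
  ext k
  simp [PowerSeries.evalNegHom, PowerSeries.coeff_rescale, PowerSeries.coeff_derivative]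
  ring

theorem evalNegHom_eSym_mul_hSym :
    PowerSeries.evalNegHom (PowerSeries.mk (eSym K)) * PowerSeries.mk (hSym K) = 1 := by
  rw [evalNegHom_mk]
  ext1 n
  rw [PowerSeries.coeff_mul, PowerSeries.coeff_one]
  simpa using sum_antidiagonal_eSym_mul_hSym n

theorem eSym_mul_evalNegHom_hSym :
    PowerSeries.mk (eSym K) * PowerSeries.evalNegHom (PowerSeries.mk (hSym K)) = 1 := by
  have h := congrArg PowerSeries.evalNegHom (evalNegHom_eSym_mul_hSym (K := K))
  rwa [map_mul, map_one, evalNegHom_evalNegHom] at h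

theorem pSym_mul_hSym :
    PowerSeries.mk (fun k => pSym K (k + 1)) * PowerSeries.mk (hSym K) =
      PowerSeries.derivative _ (PowerSeries.mk (hSym K)) := by
  ext1 n
  rw [PowerSeries.coeff_mul, PowerSeries.coeff_derivative]
  simp only [PowerSeries.coeff_mk]
  rw [sum_antidiagonal_pSym_mul_hSym, Nat.cast_succ, mul_comm]

theorem map_omegaHom_eSym :
    PowerSeries.map (omegaHom K : SymFun K →+* SymFun K) (PowerSeries.mk (eSym K)) =
      PowerSeries.mk (hSym K) := by
  ext1 n
  simp [omegaHom_eSym]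

theorem map_evalNegHom {A : Type*} [CommRing A] (φ : A →+* A) (f : PowerSeries A) :
    PowerSeries.map φ (PowerSeries.evalNegHom f) = PowerSeries.evalNegHom (PowerSeries.map φ f) := by
  ext k
  simp [PowerSeries.evalNegHom, PowerSeries.coeff_rescale]

/-- Applying ω to E(-u)H(u) = 1 shows that ω(H)(u) is inverse to H(-u); so is E(u). -/
theorem map_omegaHom_hSym :
    PowerSeries.map (omegaHom K : SymFun K →+* SymFun K) (PowerSeries.mk (hSym K)) =
      PowerSeries.mk (eSym K) := by
  have h := congrArg (PowerSeries.map (omegaHom K : SymFun K →+* SymFun K))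
    (evalNegHom_eSym_mul_hSym (K := K))
  rw [map_mul, map_one, map_evalNegHom, map_omegaHom_eSym] at h
  have h2 := eSym_mul_evalNegHom_hSym (K := K)
  exact (left_inv_eq_right_inv h2 h).symm

theorem omegaHom_hSym (k : ℕ) : omegaHom K (hSym K k) = eSym K k := by
  simpa using congrArg (PowerSeries.coeff k) (map_omegaHom_hSym (K := K))

theorem omegaHom_omegaHom (f : SymFun K) : omegaHom K (omegaHom K f) = f := by
  obtain ⟨g, rfl⟩ := eSymHom_surjective f
  have h : ((omegaHom K).comp (omegaHom K)).comp (eSymHom K) = eSymHom K := by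
    refine MvPolynomial.algHom_ext fun i => ?_
    simp [eSymHom, omegaHom_eSym, omegaHom_hSym]
  exact DFunLike.congr_fun h g

/-- Write P = H'/H. Then ω(P) = E'/E, and differentiating E(u)H(-u) = 1 gives E'(u)/E(u) = P(-u). -/
theorem omegaHom_pSym (k : ℕ) : omegaHom K (pSym K (k + 1)) = (-1) ^ k * pSym K (k + 1) := by
  set E := PowerSeries.mk (eSym K)
  set H := PowerSeries.mk (hSym K)
  set P := PowerSeries.mk fun k => pSym K (k + 1)
  have h1 : PowerSeries.evalNegHom E * H = 1 := evalNegHom_eSym_mul_hSym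
  have h1' : E * PowerSeries.evalNegHom H = 1 := eSym_mul_evalNegHom_hSym
  have h2 : P * H = PowerSeries.derivative _ H := pSym_mul_hSym
  have h3 := congrArg (PowerSeries.map (omegaHom K : SymFun K →+* SymFun K)) h2
  rw [map_mul, map_omegaHom_hSym] at h3
  have h4 : PowerSeries.map (omegaHom K : SymFun K →+* SymFun K) (PowerSeries.derivative _ H) =
      PowerSeries.derivative _ E := by
    ext1 n
    simp [E, H, PowerSeries.coeff_derivative, omegaHom_hSym]
  rw [h4] at h3
  have h5 := congrArg (PowerSeries.derivative (SymFun K)) h1'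
  rw [Derivation.leibniz, derivative_evalNegHom, ← h2, ← h3, map_mul, smul_eq_mul, smul_eq_mul,
    Derivation.map_one_eq_zero] at h5
  set P' := PowerSeries.map (omegaHom K : SymFun K →+* SymFun K) P
  have h6 : P' = PowerSeries.evalNegHom P := by
    linear_combination h5 + (PowerSeries.evalNegHom P - P') * h1'
  have h7 := congrArg (PowerSeries.coeff k) h6
  rw [evalNegHom_mk] at h7
  simpa [P', P] using h7

end Omega


/-! ### The dual Jacobi–Trudi identity -/

section DualJacobiTrudi

/-- Jacobi's identity between complementary minors of a matrix and of its inverse. -/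
theorem Matrix.det_toBlocks₁₁_of_mul_eq_one {α β R : Type*} [Fintype α] [Fintype β]
    [DecidableEq α] [DecidableEq β] [CommRing R] (M M' : Matrix (α ⊕ β) (α ⊕ β) R)
    (h : M * M' = 1) : M.toBlocks₁₁.det = M.det * M'.toBlocks₂₂.det := by
  have h12 : M.toBlocks₁₁ * M'.toBlocks₁₂ + M.toBlocks₁₂ * M'.toBlocks₂₂ = 0 ∧
      M.toBlocks₂₁ * M'.toBlocks₁₂ + M.toBlocks₂₂ * M'.toBlocks₂₂ = 1 := by
    rw [← Matrix.fromBlocks_toBlocks M, ← Matrix.fromBlocks_toBlocks M',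
      Matrix.fromBlocks_multiply, ← Matrix.fromBlocks_one, Matrix.fromBlocks_inj] at h
    exact ⟨h.2.1, h.2.2.2⟩
  have h2 : M * Matrix.fromBlocks 1 M'.toBlocks₁₂ 0 M'.toBlocks₂₂ =
      Matrix.fromBlocks M.toBlocks₁₁ 0 M.toBlocks₂₁ 1 := by
    conv_lhs => rw [← Matrix.fromBlocks_toBlocks M]
    rw [Matrix.fromBlocks_multiply, h12.1, h12.2]
    simp
  have h3 := congrArg Matrix.det h2
  rw [Matrix.det_mul, Matrix.det_fromBlocks_zero₂₁, Matrix.det_fromBlocks_zero₁₂] at h3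
  simpa using h3.symm

/-- Triangular Toeplitz matrices multiply like power series, so inverse series give inverse
matrices. Truncation at N is harmless: the terms with k > y vanish. -/
theorem sum_range_mul_eq_ite {R : Type*} [CommRing R] (a b : ℤ → R)
    (ha : ∀ k < 0, a k = 0) (hb : ∀ k < 0, b k = 0)
    (hab : ∀ n : ℕ, ∑ p ∈ antidiagonal n, b p.1 * a p.2 = if n = 0 then 1 else 0)
    (N x y : ℕ) (hy : y < N) :
    ∑ k ∈ Finset.range N, a (k - x) * b (y - k) = if x = y then 1 else 0 := by
  by_cases hxy : x ≤ y
  · obtain ⟨c, rfl⟩ := Nat.exists_eq_add_of_le hxy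
    have h := hab c
    have hc : (if c = 0 then (1 : R) else 0) = if x = x + c then 1 else 0 :=
      if_congr (by omega) rfl rfl
    rw [← hc, ← h, Finset.Nat.sum_antidiagonal_eq_sum_range_succ fun i j => b i * a j]
    symm
    rw [← Finset.sum_range_reflect]
    have hsub : Finset.Ico x (x + c + 1) ⊆ Finset.range N := by
      intro k hk
      rw [Finset.mem_Ico] at hk
      rw [Finset.mem_range]
      omega
    rw [← Finset.sum_subset hsub, Finset.sum_Ico_eq_sum_range]
    · rw [show x + c + 1 - x = c + 1 by omega]
      refine Finset.sum_congr rfl fun k hk => ?_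
      rw [Finset.mem_range] at hk
      rw [mul_comm]
      congr 2
      · push_cast [show c + 1 - 1 - k ≤ c by omega, show k ≤ c + 1 - 1 by omega]
        ring_nf
        omega
      · push_cast
        omega
    · intro k _ hk
      rw [Finset.mem_Ico, not_and_or, not_le, not_lt] at hk
      obtain hk | hk := hk
      · rw [ha _ (by omega), zero_mul]
      · rw [hb _ (by push_cast; omega), mul_zero]
  · rw [if_neg (by omega)]
    refine Finset.sum_eq_zero fun k _ => ?_
    by_cases hk : k < x
    · rw [ha _ (by omega), zero_mul]
    · rw [hb _ (by omega), mul_zero]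

/-- The row indices of the minor attached to a Young diagram, followed by the complementary ones. -/
def YoungDiagram.minorIndex (n m : ℕ) (μ : YoungDiagram) : Fin n ⊕ Fin m → ℤ :=
  Sum.elim (fun i => m + i - μ.rowLen i) (fun j => m - 1 - j + μ.colLen j)

/-- The last box of the last row can always be removed. -/
theorem YoungDiagram.exists_erase_corner (μ : YoungDiagram) (h : μ ≠ ⊥) :
    ∃ (ν : YoungDiagram) (i j : ℕ), (i, j) ∈ μ ∧ (∀ c, c ∈ ν ↔ c ∈ μ ∧ c ≠ (i, j)) ∧
      μ.rowLen i = j + 1 ∧ μ.colLen j = i + 1 := by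
  have h0 : 0 < μ.colLen 0 := by
    rw [← YoungDiagram.mem_iff_lt_colLen]
    by_contra h00
    apply h
    ext ⟨i, j⟩
    simp only [YoungDiagram.mem_cells, YoungDiagram.notMem_bot, iff_false]
    exact fun hc => h00 (μ.up_left_mem (Nat.zero_le _) (Nat.zero_le _) hc)
  set i := μ.colLen 0 - 1 with hi
  have hi0 : 0 < μ.rowLen i := by
    rw [← YoungDiagram.mem_iff_lt_rowLen, YoungDiagram.mem_iff_lt_colLen]
    omega
  set j := μ.rowLen i - 1 with hj
  have hij : (i, j) ∈ μ := by
    rw [YoungDiagram.mem_iff_lt_rowLen]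
    omega
  have hmax : ∀ i' j', (i', j') ∈ μ → i ≤ i' → j ≤ j' → i' = i ∧ j' = j := by
    intro i' j' hm hi' hj'
    have h1 : i' < μ.colLen 0 := by
      rw [← YoungDiagram.mem_iff_lt_colLen]
      exact μ.up_left_mem le_rfl (Nat.zero_le _) hm
    have h2 : i' = i := by omega
    subst h2
    rw [YoungDiagram.mem_iff_lt_rowLen] at hm
    exact ⟨rfl, by omega⟩
  have hlow : IsLowerSet (μ.cells.erase (i, j) : Set (ℕ × ℕ)) := by
    rintro ⟨a, b⟩ ⟨c, d⟩ hle hab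
    simp only [Finset.coe_erase, Set.mem_sdiff, Finset.mem_coe, YoungDiagram.mem_cells,
      Set.mem_singleton_iff] at hab ⊢
    obtain ⟨hca, hdb⟩ := hle
    refine ⟨μ.up_left_mem hca hdb hab.1, ?_⟩
    rintro h
    simp only [Prod.mk.injEq] at h
    obtain ⟨rfl, rfl⟩ := hmax a b hab.1 (h.1 ▸ hca) (h.2 ▸ hdb)
    exact hab.2 rfl
  refine ⟨⟨μ.cells.erase (i, j), hlow⟩, i, j, hij, ?_, by omega, ?_⟩
  · intro c
    rw [YoungDiagram.mem_mk, Finset.mem_erase, YoungDiagram.mem_cells, and_comm]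
  · have h1 : i < μ.colLen j := by rwa [← YoungDiagram.mem_iff_lt_colLen]
    have h2 : ¬ i + 1 < μ.colLen j := by
      rw [← YoungDiagram.mem_iff_lt_colLen]
      intro hm
      have := (hmax _ _ hm (by omega) le_rfl).1
      omega
    omega

/-- Removing a corner box (i, j) exchanges the index of row i with that of column j and leaves the
others alone. So each box contributes one transposition, and the sign is (-1) to the number of
boxes, counted by columns. -/
theorem YoungDiagram.exists_perm_minorIndex (n m : ℕ) (μ : YoungDiagram)
    (hn : μ.colLen 0 ≤ n) (hm : μ.rowLen 0 ≤ m) :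
    ∃ σ : Perm (Fin n ⊕ Fin m), (∀ x, μ.minorIndex n m x = (⊥ : YoungDiagram).minorIndex n m (σ x)) ∧
      Perm.sign σ = ∏ j : Fin m, (-1) ^ μ.colLen j := by
  induction hc : μ.card generalizing μ with
  | zero =>
    obtain rfl : μ = ⊥ := by
      ext c
      rw [Finset.card_eq_zero.mp hc]
      simp
    have h0 : ∀ j, (⊥ : YoungDiagram).colLen j = 0 := by
      intro j
      refine Nat.eq_zero_of_not_pos ?_
      rw [← YoungDiagram.mem_iff_lt_colLen]
      exact YoungDiagram.notMem_bot _
    exact ⟨1, fun x => rfl, by simp [h0]⟩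
  | succ k ih =>
    have hne : μ ≠ ⊥ := by
      rintro rfl
      simp [YoungDiagram.card] at hc
    obtain ⟨ν, i, j, hij, hν, hri, hcj⟩ := μ.exists_erase_corner hne
    have hrow : ∀ x, μ.rowLen x = ν.rowLen x + if x = i then 1 else 0 := by
      intro x
      have key : ∀ y, y < ν.rowLen x ↔ y < μ.rowLen x - if x = i then 1 else 0 := by
        intro y
        rw [← YoungDiagram.mem_iff_lt_rowLen, hν, YoungDiagram.mem_iff_lt_rowLen, Ne, Prod.mk.injEq]
        split_ifs with h
        · subst h; omega
        · simp [h]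
      have h1 := key (ν.rowLen x)
      have h2 := key (μ.rowLen x - if x = i then 1 else 0)
      split_ifs at * with h
      · subst h; omega
      · omega
    have hcol : ∀ x, μ.colLen x = ν.colLen x + if x = j then 1 else 0 := by
      intro x
      have key : ∀ y, y < ν.colLen x ↔ y < μ.colLen x - if x = j then 1 else 0 := by
        intro y
        rw [← YoungDiagram.mem_iff_lt_colLen, hν, YoungDiagram.mem_iff_lt_colLen, Ne, Prod.mk.injEq]
        split_ifs with h
        · subst h; omega
        · simp [h]
      have h1 := key (ν.colLen x)
      have h2 := key (μ.colLen x - if x = j then 1 else 0)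
      split_ifs at * with h
      · subst h; omega
      · omega
    have hcard : ν.card = k := by
      have : ν.cells = μ.cells.erase (i, j) := by
        ext c
        rw [YoungDiagram.mem_cells, hν, Finset.mem_erase, YoungDiagram.mem_cells, and_comm]
      change ν.cells.card = k
      rw [this, Finset.card_erase_of_mem (by rwa [YoungDiagram.mem_cells])]
      change μ.card - 1 = k
      omega
    obtain ⟨σ, hσ, hs⟩ := ih ν (by have := hcol 0; omega) (by have := hrow 0; omega) hcard
    have hin : i < n := by
      have := YoungDiagram.mem_iff_lt_colLen.mp (μ.up_left_mem le_rfl (Nat.zero_le _) hij)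
      omega
    have hjm : j < m := by
      have := YoungDiagram.mem_iff_lt_rowLen.mp (μ.up_left_mem (Nat.zero_le _) le_rfl hij)
      omega
    refine ⟨σ * Equiv.swap (Sum.inl ⟨i, hin⟩) (Sum.inr ⟨j, hjm⟩), fun x => ?_, ?_⟩
    · rw [Perm.mul_apply, ← hσ]
      have h1 := hrow i
      have h2 := hcol j
      rw [if_pos rfl] at h1 h2
      rcases x with ⟨x, hx⟩ | ⟨x, hx⟩
      · by_cases hxi : x = i
        · subst hxi
          rw [Equiv.swap_apply_left]
          simp only [YoungDiagram.minorIndex, Sum.elim_inl, Sum.elim_inr]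
          omega
        · rw [Equiv.swap_apply_of_ne_of_ne (by simpa using hxi) (by simp)]
          simp [YoungDiagram.minorIndex, hrow, hxi]
      · by_cases hxj : x = j
        · subst hxj
          rw [Equiv.swap_apply_right]
          simp only [YoungDiagram.minorIndex, Sum.elim_inl, Sum.elim_inr]
          omega
        · rw [Equiv.swap_apply_of_ne_of_ne (by simp) (by simpa using hxj)]
          simp [YoungDiagram.minorIndex, hcol, hxj]
    · rw [Perm.sign_mul, Perm.sign_swap (by simp), hs]
      simp only [hcol, pow_add, Finset.prod_mul_distrib]
      congr 1
      rw [Finset.prod_eq_single ⟨j, hjm⟩]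
      · simp
      · intro b _ hb
        rw [if_neg (fun h => hb (Fin.ext h)), pow_zero]
      · simp

/-- The two determinants are complementary minors of a unitriangular Toeplitz matrix and of its
inverse, so Jacobi's identity relates them. The sign is that of the permutation listing the chosen
rows followed by the complementary ones. -/
theorem YoungDiagram.det_toeplitz_eq {R : Type*} [CommRing R] (a b : ℤ → R)
    (ha : ∀ k < 0, a k = 0) (hb : ∀ k < 0, b k = 0) (ha0 : a 0 = 1)
    (hab : ∀ n : ℕ, ∑ p ∈ antidiagonal n, b p.1 * a p.2 = if n = 0 then 1 else 0)
    (n m : ℕ) (μ : YoungDiagram) (hn : μ.colLen 0 ≤ n) (hm : μ.rowLen 0 ≤ m) :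
    (Matrix.of fun i j : Fin n => a ((μ.rowLen i : ℤ) - i + j)).det =
      (∏ j : Fin m, (-1) ^ μ.colLen j) *
        (Matrix.of fun i j : Fin m => b ((μ.colLen i : ℤ) - i + j)).det := by
  -- The indexing of the empty diagram: the block of size n goes to m, …, m + n - 1 in order, the
  -- block of size m to m - 1, …, 0 in reverse.
  let e₀ : Fin n ⊕ Fin m ≃ Fin (m + n) :=
    (Equiv.sumComm _ _).trans ((Equiv.sumCongr Fin.revPerm (Equiv.refl _)).trans finSumFinEquiv)
  have hrow0 : ∀ j, (⊥ : YoungDiagram).rowLen j = 0 := by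
    intro j
    refine Nat.eq_zero_of_not_pos ?_
    rw [← YoungDiagram.mem_iff_lt_rowLen]
    exact YoungDiagram.notMem_bot _
  have hcol0 : ∀ j, (⊥ : YoungDiagram).colLen j = 0 := by
    intro j
    refine Nat.eq_zero_of_not_pos ?_
    rw [← YoungDiagram.mem_iff_lt_colLen]
    exact YoungDiagram.notMem_bot _
  have he₀ : ∀ x, ((e₀ x : ℕ) : ℤ) = (⊥ : YoungDiagram).minorIndex n m x := by
    rintro (x | x)
    · simp [e₀, YoungDiagram.minorIndex, hrow0]
    · simp [e₀, YoungDiagram.minorIndex, hcol0, Fin.val_rev]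
      omega
  obtain ⟨σ, hσ, hs⟩ := μ.exists_perm_minorIndex n m hn hm
  let T : Matrix (Fin (m + n)) (Fin (m + n)) R := Matrix.of fun i j => a ((j : ℤ) - (i : ℤ))
  let U : Matrix (Fin (m + n)) (Fin (m + n)) R := Matrix.of fun i j => b ((j : ℤ) - (i : ℤ))
  have hTU : T * U = 1 := by
    ext x y
    rw [Matrix.mul_apply, Matrix.one_apply]
    have h := sum_range_mul_eq_ite a b ha hb hab (m + n) x y y.2
    rw [Finset.sum_range] at h
    simp only [Fin.ext_iff]
    exact h
  have hT : T.det = 1 := by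
    rw [Matrix.det_of_isUpperTriangular]
    · simp [T, ha0]
    · intro i j hij
      refine ha _ ?_
      have : (j : ℕ) < i := hij
      omega
  have h1 : T.submatrix (e₀ ∘ σ) e₀ * U.submatrix e₀ (e₀ ∘ σ) = 1 := by
    rw [Matrix.submatrix_mul_equiv, hTU]
    exact Matrix.submatrix_one _ (e₀.injective.comp σ.injective)
  have h2 := Matrix.det_toBlocks₁₁_of_mul_eq_one _ _ h1
  have h3 : (T.submatrix (e₀ ∘ σ) e₀).det = ∏ j : Fin m, (-1 : R) ^ μ.colLen j := by
    have : T.submatrix (e₀ ∘ σ) e₀ = (T.submatrix e₀ e₀).submatrix σ id := rfl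
    rw [this, Matrix.det_permute, Matrix.det_submatrix_equiv_self, hT, mul_one, hs]
    push_cast
    rfl
  rw [h3] at h2
  convert h2 using 2
  · ext i j
    simp only [Matrix.of_apply, Matrix.toBlocks₁₁, Matrix.submatrix_apply, T, Function.comp_apply,
      he₀, ← hσ]
    simp only [YoungDiagram.minorIndex, Sum.elim_inl, hrow0]
    congr 1
    push_cast
    ring
  · rw [← Matrix.det_transpose]
    congr 1
    ext i j
    simp only [Matrix.transpose_apply, Matrix.of_apply, Matrix.toBlocks₂₂, Matrix.submatrix_apply, U,
      Function.comp_apply, he₀, ← hσ]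
    simp only [YoungDiagram.minorIndex, Sum.elim_inr, hcol0]
    congr 1
    push_cast
    ring

theorem neg_one_pow_mul_self {R : Type*} [CommRing R] (k : ℕ) : (-1 : R) ^ k * (-1) ^ k = 1 := by
  rw [← mul_pow]
  simp

variable {K : Type*} [CommRing K]

/-- `e_k` for an integer index, with `e_k = 0` for `k < 0`. -/
def eSymInt (K : Type*) [CommRing K] (k : ℤ) : SymFun K :=
  if k < 0 then 0 else eSym K k.toNat

theorem omegaHom_hSymInt (k : ℤ) : omegaHom K (hSymInt K k) = eSymInt K k := by
  rw [hSymInt, eSymInt]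
  split_ifs <;> simp [omegaHom_hSym]

/-- The series inverse to the h_k has coefficients (-1)^k e_k. The signs split over rows and
columns: those of i and j cancel each other, those of the column lengths cancel the sign of the
permutation. -/
theorem schur_eq_det_eSymInt (μ : YoungDiagram) :
    schur K μ = (Matrix.of fun i j : Fin (μ.rowLen 0) =>
      eSymInt K ((μ.colLen i : ℤ) - i + j)).det := by
  have h := YoungDiagram.det_toeplitz_eq (hSymInt K)
    (fun k => ((k.negOnePow : ℤ) : SymFun K) * eSymInt K k) (fun k hk => if_pos hk)
    (fun k hk => by simp [eSymInt, hk]) (by simp [hSymInt, hSym_zero]) (fun n => ?_)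
    _ _ μ le_rfl le_rfl
  · rw [schur, h]
    have h2 : (Matrix.of fun i j : Fin (μ.rowLen 0) =>
        (((((μ.colLen i : ℤ) - i + j).negOnePow : ℤˣ) : ℤ) : SymFun K) *
          eSymInt K ((μ.colLen i : ℤ) - i + j)) =
        Matrix.of fun i j : Fin (μ.rowLen 0) => ((-1) ^ (j : ℕ)) *
          (Matrix.of fun i j : Fin (μ.rowLen 0) => ((-1) ^ μ.colLen i * (-1) ^ (i : ℕ)) *
            (Matrix.of fun i j : Fin (μ.rowLen 0) =>
              eSymInt K ((μ.colLen i : ℤ) - i + j)) i j) i j := by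
      ext i j
      simp only [Matrix.of_apply, Int.negOnePow_add, Int.negOnePow_sub]
      simp only [Int.negOnePow_def, zpow_natCast]
      push_cast
      ring_nf
    rw [h2, Matrix.det_mul_row, Matrix.det_mul_column, Finset.prod_mul_distrib]
    have h3 : (∏ i : Fin (μ.rowLen 0), (-1 : SymFun K) ^ μ.colLen i) *
        ∏ i : Fin (μ.rowLen 0), (-1 : SymFun K) ^ μ.colLen i = 1 := by
      rw [← Finset.prod_mul_distrib]
      exact Finset.prod_eq_one fun i _ => neg_one_pow_mul_self _
    have h4 : (∏ i : Fin (μ.rowLen 0), (-1 : SymFun K) ^ (i : ℕ)) *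
        ∏ i : Fin (μ.rowLen 0), (-1 : SymFun K) ^ (i : ℕ) = 1 := by
      rw [← Finset.prod_mul_distrib]
      exact Finset.prod_eq_one fun i _ => neg_one_pow_mul_self _
    generalize (∏ i : Fin (μ.rowLen 0), (-1 : SymFun K) ^ μ.colLen i) = A at *
    generalize (∏ i : Fin (μ.rowLen 0), (-1 : SymFun K) ^ (i : ℕ)) = B at *
    generalize (Matrix.of fun i j : Fin (μ.rowLen 0) =>
              eSymInt K ((μ.colLen i : ℤ) - i + j)).det = D
    linear_combination (B * B * D) * h3 + D * h4
  · rw [← sum_antidiagonal_eSym_mul_hSym]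
    refine Finset.sum_congr rfl fun p _ => ?_
    simp [eSymInt, hSymInt, Int.negOnePow_def, (Int.natCast_nonneg _).not_gt]

theorem omegaHom_schur (μ : YoungDiagram) : omegaHom K (schur K μ) = schur K μ.transpose := by
  rw [schur_eq_det_eSymInt μ.transpose, schur, AlgHom.map_det]
  have h : μ.transpose.rowLen 0 = μ.colLen 0 := μ.rowLen_transpose 0
  rw [h]
  congr 1
  ext1 i j
  simp [omegaHom_hSymInt, YoungDiagram.colLen_transpose]

end DualJacobiTrudi


/-! ### The Schur functions span the ring of symmetric functions -/

section SchurSpan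

theorem YoungDiagram.exists_map_rowLen_eq (s : Multiset ℕ) (hs : ∀ x ∈ s, 0 < x) :
    ∃ μ : YoungDiagram, (Multiset.range (μ.colLen 0)).map μ.rowLen = s := by
  have hsort : (s.sort (· ≥ ·)).SortedGE := (Multiset.pairwise_sort s (· ≥ ·)).sortedGE
  refine ⟨YoungDiagram.ofRowLens _ hsort, ?_⟩
  have h := YoungDiagram.rowLens_ofRowLens_eq_self (hw := hsort) (by simpa using hs)
  have h2 := congrArg (fun l : List ℕ => (l : Multiset ℕ)) h
  simp only [Multiset.sort_eq] at h2
  exact h2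

theorem Multiset.sum_map_sq_le (s : Multiset ℕ) : (s.map (· ^ 2)).sum ≤ s.sum ^ 2 := by
  induction s using Multiset.induction_on with
  | empty => simp
  | cons a s ih =>
    simp only [Multiset.map_cons, Multiset.sum_cons]
    nlinarith [Nat.zero_le (a * s.sum)]

/-- A nontrivial permutation strictly increases the sum of squares of `ν_i + i` if `ν` is
strictly decreasing. -/
theorem sum_sq_lt_sum_sq_perm {n : ℕ} (ν : Fin n → ℤ) (hν : StrictAnti ν) (σ : Perm (Fin n))
    (hσ : σ ≠ 1) : ∑ i : Fin n, (ν i + (i : ℕ)) ^ 2 < ∑ i : Fin n, (ν (σ i) + (i : ℕ)) ^ 2 := by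
  have hanti : Antivary (fun i : Fin n => ((i : ℕ) : ℤ)) ν := by
    intro i j hij
    have := hν.lt_iff_gt.mp hij
    have : (j : ℕ) < i := this
    simp only
    omega
  have hlt : ∑ i : Fin n, ((i : ℕ) : ℤ) • ν i < ∑ i : Fin n, ((i : ℕ) : ℤ) • ν (σ i) := by
    rw [hanti.sum_mul_lt_sum_mul_comp_perm_iff]
    intro h
    apply hσ
    have hmono : StrictMono σ := by
      refine Monotone.strictMono_of_injective (fun i j hij => ?_) σ.injective
      by_contra hlt
      rw [not_le] at hlt
      have h1 := h (i := i) (j := j) (hν hlt)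
      have h2 : (j : ℕ) ≤ i := Int.ofNat_le.mp h1
      have : i = j := le_antisymm hij h2
      subst this
      exact lt_irrefl _ hlt
    ext i
    exact congrArg Fin.val (DFunLike.congr_fun (Subsingleton.elim
      (hmono.orderIsoOfSurjective σ σ.surjective) (OrderIso.refl _)) i)
  have hsq : ∑ i : Fin n, ν (σ i) ^ 2 = ∑ i : Fin n, ν i ^ 2 := Equiv.sum_comp σ fun i => ν i ^ 2
  simp only [add_sq, Finset.sum_add_distrib, hsq]
  have h1 : ∑ i : Fin n, 2 * ν i * ((i : ℕ) : ℤ) = 2 * ∑ i : Fin n, ((i : ℕ) : ℤ) • ν i := by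
    rw [Finset.mul_sum]
    exact Finset.sum_congr rfl fun i _ => by simp only [smul_eq_mul]; ring
  have h2 : ∑ i : Fin n, 2 * ν (σ i) * ((i : ℕ) : ℤ) = 2 * ∑ i : Fin n, ((i : ℕ) : ℤ) • ν (σ i) := by
    rw [Finset.mul_sum]
    exact Finset.sum_congr rfl fun i _ => by simp only [smul_eq_mul]; ring
  rw [h1, h2]
  linarith

variable {K : Type*} [CommRing K]

/-- Expanding the Jacobi–Trudi determinant, the identity permutation gives h_μ. Every other nonzero
term is ± some h_α with the same sum of parts and a larger sum of squares. As the latter is at most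
the square of the sum, induction on the difference applies. -/
theorem prod_map_hSym_mem_span_schur (s : Multiset ℕ) :
    (s.map (hSym K)).prod ∈ Submodule.span K (Set.range (schur K)) := by
  induction hM : s.sum ^ 2 - (s.map (· ^ 2)).sum using Nat.strong_induction_on generalizing s with
  | _ M ih =>
  have hfilter : ∀ s : Multiset ℕ, (s.filter (0 < ·)).sum = s.sum ∧
      ((s.filter (0 < ·)).map (· ^ 2)).sum = (s.map (· ^ 2)).sum ∧
      ((s.filter (0 < ·)).map (hSym K)).prod = (s.map (hSym K)).prod := by
    intro s
    induction s using Multiset.induction_on with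
    | empty => simp
    | cons a s ih =>
      rcases Nat.eq_zero_or_pos a with rfl | ha
      · simp [ih, hSym_zero]
      · rw [Multiset.filter_cons_of_pos s (p := (0 < ·)) ha]
        simp only [Multiset.map_cons, Multiset.sum_cons, Multiset.prod_cons, ih, and_self]
  obtain ⟨hf1, hf2, hf3⟩ := hfilter s
  obtain ⟨μ, hμ⟩ := YoungDiagram.exists_map_rowLen_eq (s.filter (0 < ·)) (by simp)
  rw [← hf1, ← hf2, ← hμ] at hM
  rw [← hf3, ← hμ]
  set ℓ := μ.colLen 0
  have hsum : ((Multiset.range ℓ).map μ.rowLen).sum = ∑ i : Fin ℓ, μ.rowLen i :=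
    Finset.sum_range μ.rowLen
  have hsq : (((Multiset.range ℓ).map μ.rowLen).map (· ^ 2)).sum = ∑ i : Fin ℓ, μ.rowLen i ^ 2 := by
    rw [Multiset.map_map]
    exact Finset.sum_range fun i => μ.rowLen i ^ 2
  have hprod : (((Multiset.range ℓ).map μ.rowLen).map (hSym K)).prod =
      ∏ i : Fin ℓ, hSym K (μ.rowLen i) := by
    rw [Multiset.map_map]
    exact Finset.prod_range fun i => hSym K (μ.rowLen i)
  rw [hsum, hsq] at hM
  rw [hprod]
  let ν : Fin ℓ → ℤ := fun i => μ.rowLen i - (i : ℕ)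
  have hν : StrictAnti ν := by
    intro i j hij
    have h1 := μ.rowLen_anti i j hij.le
    have h2 : (i : ℕ) < j := hij
    simp only [ν]
    omega
  have hdet : schur K μ = ∏ i : Fin ℓ, hSym K (μ.rowLen i) +
      ∑ σ ∈ Finset.univ.erase (1 : Perm (Fin ℓ)),
        (Perm.sign σ : ℤ) • ∏ i : Fin ℓ, hSymInt K (ν (σ i) + (i : ℕ)) := by
    rw [schur, Matrix.det_apply, ← Finset.add_sum_erase _ _ (Finset.mem_univ 1)]
    congr 1
    simp [hSymInt, (Int.natCast_nonneg _).not_gt]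
    rfl
  rw [← sub_eq_iff_eq_add] at hdet
  rw [← hdet]
  refine Submodule.sub_mem _ (Submodule.subset_span ⟨μ, rfl⟩) (Submodule.sum_mem _ fun σ hσ => ?_)
  rw [← Int.cast_smul_eq_zsmul K]
  refine Submodule.smul_mem _ _ ?_
  by_cases hneg : ∃ i, ν (σ i) + (i : ℕ) < 0
  · obtain ⟨i, hi⟩ := hneg
    rw [Finset.prod_eq_zero (f := fun i => hSymInt K (ν (σ i) + (i : ℕ))) (Finset.mem_univ i)
      (if_pos hi)]
    exact Submodule.zero_mem _
  · push Not at hneg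
    let α : Fin ℓ → ℕ := fun i => (ν (σ i) + (i : ℕ)).toNat
    have hα : ∀ i, ((α i : ℕ) : ℤ) = ν (σ i) + (i : ℕ) := fun i => Int.toNat_of_nonneg (hneg i)
    have hαprod : ∏ i, hSymInt K (ν (σ i) + (i : ℕ)) =
        ((Finset.univ.val.map α).map (hSym K)).prod := by
      rw [Multiset.map_map]
      exact Finset.prod_congr rfl fun i _ => by
        rw [hSymInt, if_neg (not_lt.mpr (hneg i))]
        rfl
    have hαsum : (Finset.univ.val.map α).sum = ∑ i : Fin ℓ, μ.rowLen i := by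
      change ∑ i, α i = _
      zify
      simp only [hα, Finset.sum_add_distrib]
      rw [Equiv.sum_comp σ ν, ← Finset.sum_add_distrib]
      simp [ν]
    have hαsq : ((Finset.univ.val.map α).map (· ^ 2)).sum = ∑ i, α i ^ 2 := by
      rw [Multiset.map_map]
      rfl
    have hlt : ∑ i : Fin ℓ, μ.rowLen i ^ 2 < ∑ i, α i ^ 2 := by
      have := sum_sq_lt_sum_sq_perm ν hν σ (Finset.ne_of_mem_erase hσ)
      zify
      simp only [hα]
      simpa [ν] using this
    rw [hαprod]
    have hle := Multiset.sum_map_sq_le (Finset.univ.val.map α)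
    rw [hαsum, hαsq] at hle
    refine ih _ ?_ _ rfl
    rw [hαsum, hαsq]
    omega

/-- Applying ω to an expression of ω(f) in the e_k expresses f in the h_k, whose products lie in the
span. -/
theorem span_range_schur : Submodule.span K (Set.range (schur K)) = ⊤ := by
  rw [eq_top_iff]
  rintro f -
  obtain ⟨g, hg⟩ := eSymHom_surjective (omegaHom K f)
  have hf : f = MvPolynomial.aeval (fun i => hSym K (i + 1)) g := by
    rw [← omegaHom_omegaHom f, ← hg, eSymHom, ← AlgHom.comp_apply, MvPolynomial.comp_aeval]
    simp only [omegaHom_eSym]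
  rw [hf, g.as_sum, map_sum]
  refine Submodule.sum_mem _ fun m _ => ?_
  rw [MvPolynomial.aeval_monomial, ← Algebra.smul_def]
  refine Submodule.smul_mem _ _ ?_
  have h := prod_map_hSym_mem_span_schur (K := K) (m.toMultiset.map (· + 1))
  rw [Multiset.map_map, Finsupp.toMultiset_map, Finsupp.prod_toMultiset] at h
  rw [Finsupp.prod_mapDomain_index (by simp) (by intros; rw [pow_add])] at h
  exact h

theorem eq_omegaHom_of_schur (ω : SymFun K →ₗ[K] SymFun K)
    (h : ∀ μ : YoungDiagram, ω (schur K μ) = schur K μ.transpose) :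
    ω = (omegaHom K).toLinearMap := by
  refine LinearMap.ext_on (span_range_schur (K := K)) ?_
  rintro _ ⟨μ, rfl⟩
  rw [h]
  exact (omegaHom_schur μ).symm

theorem existsUnique_omega : ∃! ω : SymFun K →ₗ[K] SymFun K,
    ∀ μ : YoungDiagram, ω (schur K μ) = schur K μ.transpose :=
  ⟨(omegaHom K).toLinearMap, omegaHom_schur, eq_omegaHom_of_schur⟩

/-- The sign of ω on p_λ is (-1)^{|λ| - ℓ(λ)}, the sign of a permutation of cycle type λ. The
exponent is written as a sum, which has the same parity. -/
theorem omegaHom_pSymPart {n : ℕ} (g : Perm (Fin n)) :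
    omegaHom K (pSymPart K g.partition) = ((Perm.sign g : ℤ) : K) • pSymPart K g.partition := by
  have hgen : ∀ s : Multiset ℕ, (∀ k ∈ s, 0 < k) → omegaHom K (s.map (pSym K)).prod =
      (-1 : SymFun K) ^ (s.sum + s.card) * (s.map (pSym K)).prod := by
    intro s hs
    induction s using Multiset.induction_on with
    | empty => simp
    | cons a s ih =>
      obtain ⟨k, rfl⟩ := Nat.exists_eq_succ_of_ne_zero
        (Nat.pos_iff_ne_zero.mp (hs a (Multiset.mem_cons_self _ _)))
      rw [Multiset.map_cons, Multiset.prod_cons, map_mul, omegaHom_pSym,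
        ih fun k hk => hs k (Multiset.mem_cons_of_mem hk), Multiset.sum_cons, Multiset.card_cons]
      have : (-1 : SymFun K) ^ (k.succ + s.sum + (s.card + 1)) =
          (-1) ^ k * (-1) ^ (s.sum + s.card) := by
        have hR : ∀ (R : Type _) [CommRing R] (a b : ℕ), (-1 : R) ^ (a + b + 2) =
            (-1) ^ a * (-1) ^ b := fun R _ a b => by rw [pow_add, pow_add, neg_one_sq, mul_one]
        rw [show k.succ + s.sum + (s.card + 1) = k + (s.sum + s.card) + 2 by omega]
        exact hR _ _ _
      rw [this]
      ring
  rw [pSymPart, hgen _ fun k hk => g.partition.parts_pos hk, Perm.sign_of_cycleType]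
  have hpow : (-1 : SymFun K) ^ (g.partition.parts.sum + g.partition.parts.card) =
      (-1) ^ (g.cycleType.sum + g.cycleType.card) := by
    rw [Perm.parts_partition, Multiset.sum_add, Multiset.card_add, Multiset.sum_replicate,
      Multiset.card_replicate, smul_eq_mul, mul_one]
    -- The c fixed points are parts of the partition but not of `cycleType`; they add 2c to the
    -- exponent.
    generalize Fintype.card (Fin n) - g.support.card = c
    rw [show g.cycleType.sum + c + (g.cycleType.card + c) =
      g.cycleType.sum + g.cycleType.card + (c + c) by omega, pow_add, pow_add _ c c,
      neg_one_pow_mul_self, mul_one]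
  rw [hpow, Algebra.smul_def]
  push_cast
  rfl

end SchurSpan


/-! ### The flip map `f(x, y) ↦ f(∂x, y) Δ(x)` -/

section Flip

open MvPolynomial

/-- The operators `∂/∂x_i` and multiplication by `y_i`. -/
def mixedGen (n : ℕ) : Fin n ⊕ Fin n → Module.End ℂ (PolyXY n) :=
  Sum.elim (fun i => (pderiv (Sum.inl i)).toLinearMap)
    (fun i => LinearMap.mulLeft ℂ (X (Sum.inr i)))

theorem mixedGen_commute {n : ℕ} (a b : Fin n ⊕ Fin n) : Commute (mixedGen n a) (mixedGen n b) := by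
  rcases a with i | i <;> rcases b with j | j
  · exact pderiv_commute _ _
  · refine LinearMap.ext fun p => ?_
    simp [mixedGen, Derivation.leibniz]
  · refine LinearMap.ext fun p => ?_
    simp [mixedGen, Derivation.leibniz]
  · refine LinearMap.ext fun p => ?_
    simp only [mixedGen, Sum.elim_inr, Module.End.mul_apply, LinearMap.mulLeft_apply]
    ring

open scoped IsMulCommutative in
/-- `f ↦ f(∂x, y)`: the algebra homomorphism replacing `x_i` by `∂/∂x_i` and `y_i` by
multiplication by `y_i`. -/
def mixedOp (n : ℕ) : PolyXY n →ₐ[ℂ] Module.End ℂ (PolyXY n) :=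
  haveI : IsMulCommutative (Algebra.adjoin ℂ (Set.range (mixedGen n))) :=
    Algebra.isMulCommutative_adjoin ℂ (by
      rintro _ ⟨i, rfl⟩ _ ⟨j, rfl⟩
      exact mixedGen_commute i j)
  (Algebra.adjoin ℂ (Set.range (mixedGen n))).val.comp
    (aeval fun i => ⟨mixedGen n i, Algebra.subset_adjoin ⟨i, rfl⟩⟩)

theorem mixedOp_X {n : ℕ} (i : Fin n ⊕ Fin n) : mixedOp n (X i) = mixedGen n i := by
  simp [mixedOp]

/-- The Vandermonde determinant in the variables `x`. -/
def vandermondeX (n : ℕ) : PolyXY n :=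
  (Matrix.vandermonde fun i : Fin n => (X (Sum.inl i) : PolyXY n)).det

/-- The flip map `f ↦ f(∂x, y) Δ(x)`. -/
def flipX (n : ℕ) : PolyXY n →ₗ[ℂ] PolyXY n :=
  (LinearMap.applyₗ (vandermondeX n)).comp (mixedOp n).toLinearMap

theorem flipX_apply {n : ℕ} (f : PolyXY n) : flipX n f = mixedOp n f (vandermondeX n) := rfl

theorem flipX_mul {n : ℕ} (f g : PolyXY n) : flipX n (f * g) = mixedOp n f (flipX n g) := by
  rw [flipX_apply, flipX_apply, map_mul, Module.End.mul_apply]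

/-- The exponents `m`, `s` add up to `σ` in the variables `x` and agree in the variables `y`. -/
def IsFlipPair {n : ℕ} (σ : Perm (Fin n)) (s m : Fin n ⊕ Fin n →₀ ℕ) : Prop :=
  ∀ i, m (Sum.inl i) + s (Sum.inl i) = σ i ∧ m (Sum.inr i) = s (Sum.inr i)

open Classical in
theorem coeff_vandermondeX {n : ℕ} (m : Fin n ⊕ Fin n →₀ ℕ) :
    coeff m (vandermondeX n) =
      ∑ σ : Perm (Fin n), if IsFlipPair σ 0 m then ((Perm.sign σ : ℤ) : ℂ) else 0 := by
  rw [vandermondeX, ← Matrix.det_transpose, Matrix.det_apply', coeff_sum]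
  refine Finset.sum_congr rfl fun σ _ => ?_
  let st : Fin n ⊕ Fin n →₀ ℕ :=
    Finsupp.equivFunOnFinite.symm (Sum.elim (fun i => (σ i : ℕ)) fun _ => 0)
  have hmon : ∏ i, (Matrix.vandermonde fun i : Fin n => (X (Sum.inl i) : PolyXY n)).transpose (σ i) i =
      monomial st 1 := by
    rw [monomial_eq, Finsupp.prod_fintype _ _ (by simp), Fintype.prod_sum_type]
    simp [st, Matrix.vandermonde_apply]
  have hst : IsFlipPair σ 0 m ↔ st = m := by
    constructor
    · intro h
      ext (i | i)
      · simpa [st] using (h i).1.symm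
      · simpa [st] using (h i).2.symm
    · rintro rfl i
      simp [st]
  have hsign : ((Perm.sign σ : ℤ) : PolyXY n) = C ((Perm.sign σ : ℤ) : ℂ) := by simp
  rw [hmon, hsign, coeff_C_mul, coeff_monomial]
  simp only [hst, mul_ite, mul_one, mul_zero]

-- Δ is the signed sum of the monomials x^σ = ∏ x_i^{σ(i)}, and ∂^s x^σ = (σ!/m!) x^m with m = σ -
-- s. Here σ! = ∏ σ(i)! does not depend on σ. With m! cleared, the right side depends on s and m
-- only through a relation that is symmetric in them.
open Classical Nat in
theorem coeff_flipX_monomial {n : ℕ} (s m : Fin n ⊕ Fin n →₀ ℕ) :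
    (∏ i, ((m (Sum.inl i))! : ℂ)) * coeff m (flipX n (monomial s 1)) =
      (∏ i : Fin n, ((i : ℕ)! : ℂ)) *
        ∑ σ : Perm (Fin n), if IsFlipPair σ s m then ((Perm.sign σ : ℤ) : ℂ) else 0 := by
  induction hk : s.degree generalizing s m with
  | zero =>
    obtain rfl := (Finsupp.degree_eq_zero_iff s).mp hk
    have h1 : flipX n (monomial 0 1) = vandermondeX n := by
      rw [flipX_apply, ← C_apply, C_1, map_one, Module.End.one_apply]
    rw [h1, coeff_vandermondeX, Finset.mul_sum, Finset.mul_sum]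
    refine Finset.sum_congr rfl fun σ _ => ?_
    split_ifs with h
    · congr 1
      rw [← Equiv.prod_comp σ fun i : Fin n => ((i : ℕ)! : ℂ)]
      refine Finset.prod_congr rfl fun i _ => ?_
      rw [← (h i).1]
      simp
    · simp
  | succ k ih =>
    obtain ⟨a, ha⟩ : ∃ a, s a ≠ 0 := by
      by_contra! h
      have : s = 0 := Finsupp.ext h
      simp [this] at hk
    obtain ⟨s, rfl⟩ : ∃ s', s = s' + Finsupp.single a 1 :=
      ⟨s - Finsupp.single a 1, (tsub_add_cancel_of_le (by
        rw [Finsupp.single_le_iff]; omega)).symm⟩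
    have hk' : s.degree = k := by
      rw [map_add, Finsupp.degree_single] at hk
      omega
    have h1 : flipX n (monomial (s + Finsupp.single a 1) 1) =
        mixedGen n a (flipX n (monomial s 1)) := by
      rw [add_comm, ← one_mul (1 : ℂ), ← monomial_mul, flipX_mul, one_mul]
      change mixedOp n (X a) _ = _
      rw [mixedOp_X]
    rw [h1]
    rcases a with i | i
    · change _ * coeff m (pderiv (Sum.inl i) _) = _
      rw [coeff_pderiv]
      have h2 := ih s (m + Finsupp.single (Sum.inl i) 1) hk'
      have h3 : ∏ j, (((m + Finsupp.single (Sum.inl i) 1 : Fin n ⊕ Fin n →₀ ℕ) (Sum.inl j))! : ℂ) =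
          (∏ j, ((m (Sum.inl j))! : ℂ)) * (m (Sum.inl i) + 1) := by
        rw [← Finset.mul_prod_erase _ _ (Finset.mem_univ i),
          ← Finset.mul_prod_erase _ (fun j => ((m (Sum.inl j))! : ℂ)) (Finset.mem_univ i)]
        have : ∏ j ∈ Finset.univ.erase i, (((m + Finsupp.single (Sum.inl i) 1 : Fin n ⊕ Fin n →₀ ℕ) (Sum.inl j))! : ℂ) =
            ∏ j ∈ Finset.univ.erase i, ((m (Sum.inl j))! : ℂ) := by
          refine Finset.prod_congr rfl fun j hj => ?_
          have hne : (Sum.inl i : Fin n ⊕ Fin n) ≠ Sum.inl j := by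
            simpa using (Finset.ne_of_mem_erase hj).symm
          rw [Finsupp.add_apply, Finsupp.single_eq_of_ne' hne, add_zero]
        rw [this, Finsupp.add_apply, Finsupp.single_eq_same, Nat.factorial_succ]
        push_cast
        ring
      rw [h3] at h2
      -- Only the sum of the two exponents of x_i matters, so the unit moves from s to m.
      have h4 : ∀ σ, IsFlipPair σ (s + Finsupp.single (Sum.inl i) 1) m ↔
          IsFlipPair σ s (m + Finsupp.single (Sum.inl i) 1) := by
        intro σ
        refine forall_congr' fun j => ?_
        simp only [Finsupp.add_apply]
        rw [Finsupp.single_eq_of_ne (a := Sum.inl i) (a' := Sum.inr j) (by simp)]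
        constructor <;> rintro ⟨h5, h6⟩ <;> exact ⟨by omega, by omega⟩
      simp only [h4]
      rw [← h2]
      ring
    · change _ * coeff m (X (Sum.inr i) * _) = _
      rw [coeff_X_mul']
      by_cases hm : Sum.inr i ∈ m.support
      · rw [if_pos hm]
        obtain ⟨m, rfl⟩ : ∃ m', m = m' + Finsupp.single (Sum.inr i) 1 :=
          ⟨m - Finsupp.single (Sum.inr i) 1, (tsub_add_cancel_of_le (by
            rw [Finsupp.single_le_iff]
            exact Nat.one_le_iff_ne_zero.mpr (Finsupp.mem_support_iff.mp hm))).symm⟩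
        rw [add_tsub_cancel_right]
        have h2 := ih s m hk'
        have h4 : ∀ σ, IsFlipPair σ (s + Finsupp.single (Sum.inr i) 1)
            (m + Finsupp.single (Sum.inr i) 1) ↔ IsFlipPair σ s m := by
          intro σ
          refine forall_congr' fun j => ?_
          simp only [Finsupp.add_apply]
          rw [Finsupp.single_eq_of_ne (a := Sum.inr i) (a' := Sum.inl j) (by simp)]
          constructor <;> rintro ⟨h5, h6⟩ <;> exact ⟨by omega, by omega⟩
        simp only [h4]
        rw [← h2]
        congr 1
        refine Finset.prod_congr rfl fun j _ => ?_
        rw [Finsupp.add_apply, Finsupp.single_eq_of_ne (by simp), add_zero]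
      · rw [if_neg hm, mul_zero, eq_comm]
        refine mul_eq_zero_of_right _ (Finset.sum_eq_zero fun σ _ => if_neg fun h => ?_)
        have := (h i).2
        rw [Finsupp.notMem_support_iff.mp hm] at this
        simp at this

theorem IsFlipPair.unique {n : ℕ} {σ τ : Perm (Fin n)} {s m : Fin n ⊕ Fin n →₀ ℕ}
    (h : IsFlipPair σ s m) (h' : IsFlipPair τ s m) : σ = τ := by
  ext i
  rw [← (h i).1, (h' i).1]

/-- The exponents determine σ, so at most one permutation contributes and nothing cancels. -/
theorem coeff_flipX_monomial_ne_zero_iff {n : ℕ} (s m : Fin n ⊕ Fin n →₀ ℕ) :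
    coeff m (flipX n (monomial s 1)) ≠ 0 ↔ ∃ σ, IsFlipPair σ s m := by
  classical
  have hne : ∀ f : Fin n → ℕ, (∏ i, ((f i).factorial : ℂ)) ≠ 0 := fun f =>
    Finset.prod_ne_zero_iff.mpr fun i _ => Nat.cast_ne_zero.mpr (Nat.factorial_ne_zero _)
  have h := coeff_flipX_monomial s m
  constructor
  · intro h0
    have h1 := mul_ne_zero (hne fun i => m (Sum.inl i)) h0
    rw [h] at h1
    obtain ⟨σ, _, hσ⟩ := Finset.exists_ne_zero_of_sum_ne_zero (right_ne_zero_of_mul h1)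
    refine ⟨σ, ?_⟩
    by_contra hσ'
    exact hσ (if_neg hσ')
  · rintro ⟨σ, hσ⟩ h0
    rw [h0, mul_zero, Finset.sum_eq_single σ, if_pos hσ] at h
    · have h1 := mul_ne_zero (hne fun i => (i : ℕ)) (b := (((Perm.sign σ : ℤ)) : ℂ)) (by simp)
      exact h1 h.symm
    · intro τ _ hτ
      exact if_neg fun h' => hτ (h'.unique hσ)
    · simp

end Flip


/-! ### The scalar product and the flip map -/

section Pairing

open MvPolynomial

open Nat in
theorem polyPairing_monomial {σ : Type*} [Fintype σ] (s : σ →₀ ℕ) (Q : MvPolynomial σ ℂ) :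
    polyPairing σ (monomial s 1) Q = (∏ i, ((s i)! : ℂ)) * coeff s Q := by
  classical
  induction hk : s.degree generalizing s Q with
  | zero =>
    obtain rfl := (Finsupp.degree_eq_zero_iff s).mp hk
    rw [polyPairing_apply, ← C_apply, C_1, map_one, Module.End.one_apply]
    simp [← constantCoeff_eq, aeval_zero]
  | succ k ih =>
    obtain ⟨a, ha⟩ : ∃ a, s a ≠ 0 := by
      by_contra! h
      have : s = 0 := Finsupp.ext h
      simp [this] at hk
    obtain ⟨s, rfl⟩ : ∃ s', s = s' + Finsupp.single a 1 :=
      ⟨s - Finsupp.single a 1, (tsub_add_cancel_of_le (by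
        rw [Finsupp.single_le_iff]; omega)).symm⟩
    have hk' : s.degree = k := by
      rw [map_add, Finsupp.degree_single] at hk
      omega
    have h1 : polyPairing σ (monomial (s + Finsupp.single a 1) 1) Q =
        polyPairing σ (monomial s 1) (pderiv a Q) := by
      rw [polyPairing_apply, polyPairing_apply, ← one_mul (1 : ℂ), ← monomial_mul, map_mul,
        Module.End.mul_apply, one_mul]
      change aeval _ (diffOp σ _ (diffOp σ (X a) Q)) = _
      rw [diffOp_X]
    rw [h1, ih _ _ hk', coeff_pderiv, ← Finset.mul_prod_erase _ _ (Finset.mem_univ a),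
      ← Finset.mul_prod_erase _ (fun i => (((s + Finsupp.single a 1 : σ →₀ ℕ) i)! : ℂ)) (Finset.mem_univ a)]
    have : ∏ j ∈ Finset.univ.erase a, (((s + Finsupp.single a 1 : σ →₀ ℕ) j)! : ℂ) =
        ∏ j ∈ Finset.univ.erase a, ((s j)! : ℂ) := by
      refine Finset.prod_congr rfl fun j hj => ?_
      rw [Finsupp.add_apply, Finsupp.single_eq_of_ne (Finset.ne_of_mem_erase hj), add_zero]
    rw [this, Finsupp.add_apply, Finsupp.single_eq_same, Nat.factorial_succ]
    push_cast
    ring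

theorem polyPairing_eq_sum {σ : Type*} [Fintype σ] (P Q : MvPolynomial σ ℂ) :
    polyPairing σ P Q =
      ∑ s ∈ P.support, coeff s P * ((∏ i, ((s i).factorial : ℂ)) * coeff s Q) := by
  conv_lhs => rw [P.as_sum]
  rw [map_sum, LinearMap.sum_apply]
  refine Finset.sum_congr rfl fun s _ => ?_
  rw [← mul_one (coeff s P), ← smul_eq_mul, ← smul_monomial, map_smul, LinearMap.smul_apply,
    polyPairing_monomial, smul_eq_mul, smul_eq_mul, mul_one]

theorem polyPairing_comm {σ : Type*} [Fintype σ] (P Q : MvPolynomial σ ℂ) :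
    polyPairing σ P Q = polyPairing σ Q P := by
  classical
  have h : polyPairing σ = (polyPairing σ).flip := by
    refine (basisMonomials σ ℂ).ext fun s => (basisMonomials σ ℂ).ext fun r => ?_
    change _ = polyPairing σ (basisMonomials σ ℂ r) (basisMonomials σ ℂ s)
    simp only [coe_basisMonomials]
    rw [polyPairing_monomial, polyPairing_monomial, coeff_monomial, coeff_monomial]
    by_cases h : r = s
    · subst h; rfl
    · rw [if_neg h, if_neg (Ne.symm h), mul_zero, mul_zero]
  exact LinearMap.congr_fun₂ h P Q

theorem IsFlipPair.symm {n : ℕ} {σ : Perm (Fin n)} {s m : Fin n ⊕ Fin n →₀ ℕ}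
    (h : IsFlipPair σ s m) : IsFlipPair σ m s :=
  fun i => ⟨by rw [add_comm]; exact (h i).1, (h i).2.symm⟩

/-- On monomials, the x-factorials of the scalar product are exactly those needed to clear
denominators in `coeff_flipX_monomial`. What remains is symmetric, since paired exponents agree in
y. -/
theorem polyPairing_flipX {n : ℕ} (P Q : PolyXY n) :
    polyPairing _ P (flipX n Q) = polyPairing _ (flipX n P) Q := by
  classical
  rw [polyPairing_comm (flipX n P)]
  have h : (polyPairing (Fin n ⊕ Fin n)).compl₂ (flipX n) =
      ((polyPairing (Fin n ⊕ Fin n)).compl₂ (flipX n)).flip := by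
    refine (basisMonomials _ ℂ).ext fun s => (basisMonomials _ ℂ).ext fun r => ?_
    rw [LinearMap.flip_apply, LinearMap.compl₂_apply, LinearMap.compl₂_apply]
    simp only [coe_basisMonomials]
    rw [polyPairing_monomial, polyPairing_monomial, Fintype.prod_sum_type, Fintype.prod_sum_type,
      mul_right_comm, coeff_flipX_monomial, mul_right_comm _ _ (coeff r _), coeff_flipX_monomial]
    simp only [mul_assoc, Finset.sum_mul]
    congr 1
    refine Finset.sum_congr rfl fun σ _ => ?_
    by_cases hσ : IsFlipPair σ r s
    · rw [if_pos hσ, if_pos hσ.symm]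
      congr 1
      exact Finset.prod_congr rfl fun i _ => by rw [(hσ i).2]
    · rw [if_neg hσ, if_neg fun h => hσ h.symm, zero_mul, zero_mul]
  exact LinearMap.congr_fun₂ h P Q

/-- The scalar product is bilinear, not Hermitian; conjugating one argument restores positivity. -/
theorem map_conj_mem_invariantIdeal {n : ℕ} {f : PolyXY n} (hf : f ∈ invariantIdeal n) :
    MvPolynomial.map (starRingEnd ℂ) f ∈ invariantIdeal n := by
  have hle : invariantIdeal n ≤ (invariantIdeal n).comap (MvPolynomial.map (starRingEnd ℂ)) := by
    refine Ideal.span_le.mpr ?_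
    rintro g ⟨hg, hg0⟩
    refine Ideal.subset_span ⟨fun σ τ => ?_, ?_⟩
    · rw [← MvPolynomial.map_rename, hg]
    · rw [constantCoeff_map, hg0, map_zero]
  exact hle hf

/-- The ideal meets the bihomogeneous components of the harmonics trivially. -/
theorem eq_zero_of_mem_invariantIdeal_of_mem_bigradedPiece {n : ℕ} {d : ℕ × ℕ} {v : PolyXY n}
    (hv : v ∈ (bigradedPiece (harmonicsRep n) d).toSubmodule) (hI : v ∈ invariantIdeal n) :
    v = 0 := by
  classical
  obtain ⟨p, hp, rfl⟩ := hv
  set v := weightedHomogeneousComponent (bidegree n) d p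
  -- Pairing with the harmonic p rather than with its component v suffices: only coefficients of p
  -- on the support of v enter, and there p and v agree. So this gives ∑ s! |v_s|² = 0.
  have h0 : polyPairing _ (MvPolynomial.map (starRingEnd ℂ) v) p = 0 :=
    hp _ (map_conj_mem_invariantIdeal hI)
  have hsupp : (MvPolynomial.map (starRingEnd ℂ) v).support = v.support :=
    support_map_of_injective _ (starRingEnd ℂ).injective
  rw [polyPairing_eq_sum, hsupp] at h0
  have h1 : ∀ s ∈ v.support, coeff s (MvPolynomial.map (starRingEnd ℂ) v) *
      ((∏ i, ((s i).factorial : ℂ)) * coeff s p) =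
      (((∏ i, ((s i).factorial : ℝ)) * Complex.normSq (coeff s v) : ℝ) : ℂ) := by
    intro s hs
    have : coeff s p = coeff s v := by
      rw [mem_support_iff] at hs
      simp only [v, coeff_weightedHomogeneousComponent] at hs ⊢
      split_ifs at hs ⊢ with h
      · rfl
      · exact absurd rfl hs
    rw [this, coeff_map]
    push_cast
    rw [Complex.normSq_eq_conj_mul_self]
    ring
  rw [Finset.sum_congr rfl h1, ← Complex.ofReal_sum, Complex.ofReal_eq_zero,
    Finset.sum_eq_zero_iff_of_nonneg fun s _ => by
      have := Complex.normSq_nonneg (coeff s v)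
      positivity] at h0
  have hlin : v.support = ∅ := by
    rw [Finset.eq_empty_iff_forall_notMem]
    intro s hs
    have h2 := h0 s hs
    rw [mul_eq_zero, Complex.normSq_eq_zero] at h2
    rcases h2 with h2 | h2
    · rw [Finset.prod_eq_zero_iff] at h2
      obtain ⟨i, _, hi⟩ := h2
      exact Nat.factorial_ne_zero _ (by exact_mod_cast hi)
    · exact (mem_support_iff.mp hs) h2
  exact support_eq_empty.mp hlin

theorem mixedOp_rename {n : ℕ} (σ τ : Perm (Fin n)) (P Q : PolyXY n) :
    mixedOp n (rename (Sum.map σ τ) P) (rename (Sum.map σ τ) Q) =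
      rename (Sum.map σ τ) (mixedOp n P Q) := by
  have hinj : Function.Injective (Sum.map σ τ) := σ.injective.sumMap τ.injective
  induction P using MvPolynomial.induction_on generalizing Q with
  | C a =>
    rw [rename_C, ← algebraMap_eq, AlgHom.commutes]
    simp [Module.algebraMap_end_apply]
  | add p q hp hq => simp [hp, hq]
  | mul_X p i hp =>
    rw [map_mul, map_mul, map_mul, rename_X, Module.End.mul_apply,
      Module.End.mul_apply, mixedOp_X, mixedOp_X, ← hp]
    congr 1
    rcases i with i | i
    · exact pderiv_rename hinj (Sum.inl i) Q
    · simp [mixedGen]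

theorem rename_vandermondeX {n : ℕ} (σ τ : Perm (Fin n)) :
    rename (Sum.map σ τ) (vandermondeX n) = ((Perm.sign σ : ℤ) : ℂ) • vandermondeX n := by
  rw [vandermondeX, AlgHom.map_det]
  have h : (rename (Sum.map σ τ)).mapMatrix
      (Matrix.vandermonde fun i : Fin n => (X (Sum.inl i) : PolyXY n)) =
      (Matrix.vandermonde fun i : Fin n => (X (Sum.inl i) : PolyXY n)).submatrix σ id := by
    ext1 i j
    simp [Matrix.vandermonde_apply]
  rw [h, Matrix.det_permute, smul_eq_C_mul]
  simp

/-- The operators are equivariant and Δ(x) is alternating; τ gives no sign because Δ does not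
involve y. -/
theorem flipX_rename {n : ℕ} (σ τ : Perm (Fin n)) (f : PolyXY n) :
    flipX n (rename (Sum.map σ τ) f) =
      ((Perm.sign σ : ℤ) : ℂ) • rename (Sum.map σ τ) (flipX n f) := by
  have hs : ((Perm.sign σ : ℤ) : ℂ) * ((Perm.sign σ : ℤ) : ℂ) = 1 := by
    rcases Int.units_eq_one_or (Perm.sign σ) with h | h <;> simp [h]
  have h : vandermondeX n =
      ((Perm.sign σ : ℤ) : ℂ) • rename (Sum.map σ τ) (vandermondeX n) := by
    rw [rename_vandermondeX, smul_smul, hs, one_smul]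
  rw [flipX_apply]
  conv_lhs => rw [h]
  rw [map_smul, mixedOp_rename, ← flipX_apply]

/-- Setting the variables `x` to zero. -/
def evalXZero (n : ℕ) : PolyXY n →ₐ[ℂ] PolyXY n :=
  aeval (Sum.elim (fun _ => 0) fun i => X (Sum.inr i))

theorem evalXZero_rename {n : ℕ} (σ τ : Perm (Fin n)) (f : PolyXY n) :
    evalXZero n (rename (Sum.map σ τ) f) = rename (Sum.map σ τ) (evalXZero n f) := by
  have h : (evalXZero n).comp (rename (Sum.map σ τ)) =
      (rename (Sum.map σ τ)).comp (evalXZero n) := by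
    refine algHom_ext fun i => ?_
    rcases i with i | i <;> simp [evalXZero]
  exact DFunLike.congr_fun h f

theorem evalXZero_rename_left {n : ℕ} (σ : Perm (Fin n)) (f : PolyXY n) :
    rename (Sum.map σ (1 : Perm (Fin n))) (evalXZero n f) = evalXZero n f := by
  have h : (rename (Sum.map σ (1 : Perm (Fin n)))).comp (evalXZero n) = evalXZero n := by
    refine algHom_ext fun i => ?_
    rcases i with i | i <;> simp [evalXZero]
  exact DFunLike.congr_fun h f

theorem constantCoeff_evalXZero {n : ℕ} (f : PolyXY n) :
    constantCoeff (evalXZero n f) = constantCoeff f := by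
  induction f using MvPolynomial.induction_on with
  | C a => simp [evalXZero]
  | add p q hp hq => simp [hp, hq]
  | mul_X p i hp =>
    rcases i with i | i <;> simp [evalXZero]

theorem evalXZero_monomial {n : ℕ} (s : Fin n ⊕ Fin n →₀ ℕ) :
    evalXZero n (monomial s 1) = if ∀ i, s (Sum.inl i) = 0 then monomial s 1 else 0 := by
  rw [evalXZero, aeval_monomial, Finsupp.prod_fintype _ _ (by simp), Fintype.prod_sum_type, map_one,
    one_mul]
  split_ifs with h
  · rw [monomial_eq, Finsupp.prod_fintype _ _ (by simp), Fintype.prod_sum_type]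
    simp [h]
  · push Not at h
    obtain ⟨i, hi⟩ := h
    rw [Finset.prod_eq_zero (Finset.mem_univ i), zero_mul]
    simp [hi]

theorem mixedOp_evalXZero {n : ℕ} (f g : PolyXY n) :
    mixedOp n (evalXZero n f) g = evalXZero n f * g := by
  induction f using MvPolynomial.induction_on generalizing g with
  | C a => simp [evalXZero, ← algebraMap_eq, Module.algebraMap_end_apply, Algebra.smul_def]
  | add p q hp hq => simp [hp, hq, add_mul]
  | mul_X p i hp =>
    rw [map_mul, map_mul, Module.End.mul_apply, hp]
    rcases i with i | i
    · simp [evalXZero]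
    · have : evalXZero n (X (Sum.inr i)) = X (Sum.inr i) := by simp [evalXZero]
      rw [this, mixedOp_X]
      simp [mixedGen, mul_assoc]

/-- Such an f takes each value 0, …, n - 1 once, so both sides have the same sum and no inequality
is strict. -/
theorem eq_of_injective_of_le_perm {n : ℕ} (f : Fin n → ℕ) (hf : Function.Injective f)
    (σ : Perm (Fin n)) (hle : ∀ i, f i ≤ σ i) (i : Fin n) : f i = σ i := by
  let g : Fin n → Fin n := fun i => ⟨f i, (hle i).trans_lt (σ i).2⟩
  have hg : Function.Bijective g := Finite.injective_iff_bijective.mp fun a b hab =>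
    hf (congrArg Fin.val hab)
  have h1 : ∑ i, f i = ∑ i, (σ i : ℕ) := by
    rw [Equiv.sum_comp σ fun i => (i : ℕ), ← Equiv.sum_comp (Equiv.ofBijective g hg) fun i => (i : ℕ)]
    rfl
  exact (Finset.sum_eq_sum_iff_of_le fun i _ => hle i).mp h1 i (Finset.mem_univ i)

/-- The difference is alternating in x, so its monomials have distinct x-exponents. Each arises from
some x^σ by differentiation, so its exponents are bounded by σ and hence equal to it; but then no
derivative in x was taken, although only the part of Q involving x contributes. -/
theorem flipX_eq_flipX_evalXZero {n : ℕ} (Q : PolyXY n)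
    (hQ : ∀ σ : Perm (Fin n), rename (Sum.map σ (1 : Perm (Fin n))) Q = Q) :
    flipX n Q = flipX n (evalXZero n Q) := by
  classical
  rw [← sub_eq_zero]
  set G := flipX n Q - flipX n (evalXZero n Q) with hG
  have hanti : ∀ σ : Perm (Fin n), rename (Sum.map σ (1 : Perm (Fin n))) G =
      ((Perm.sign σ : ℤ) : ℂ) • G := by
    intro σ
    have hs : ((Perm.sign σ : ℤ) : ℂ) * ((Perm.sign σ : ℤ) : ℂ) = 1 := by
      rcases Int.units_eq_one_or (Perm.sign σ) with h | h <;> simp [h]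
    have h1 := flipX_rename σ 1 (Q - evalXZero n Q)
    rw [map_sub (rename (R := ℂ) (Sum.map σ (1 : Perm (Fin n)))), hQ, evalXZero_rename_left, map_sub (flipX n), ← hG] at h1
    conv_rhs => rw [h1]
    rw [smul_smul, hs, one_smul]
  ext m
  rw [coeff_zero]
  by_contra hm
  have hinj : Function.Injective fun i => m (Sum.inl i) := by
    intro i j hij
    by_contra hne
    have h1 := hanti (Equiv.swap i j)
    rw [Perm.sign_swap hne] at h1
    have hmap : m.mapDomain (Sum.map (Equiv.swap i j) (1 : Perm (Fin n))) = m := by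
      have : m.mapDomain (Equiv.sumCongr (Equiv.swap i j) (1 : Perm (Fin n))) = m := by
        ext a
        rw [Finsupp.mapDomain_equiv_apply]
        rcases a with a | a
        · simp only [Equiv.sumCongr_symm, Equiv.symm_swap, Equiv.sumCongr_apply, Sum.map_inl]
          rw [Equiv.swap_apply_def]
          split_ifs with h2 h3
          · rw [h2]; exact hij.symm
          · rw [h3]; exact hij
          · rfl
        · rfl
      exact this
    have h2 := coeff_rename_mapDomain (Sum.map (Equiv.swap i j) (1 : Perm (Fin n)))
      ((Equiv.swap i j).injective.sumMap (1 : Perm (Fin n)).injective) G m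
    rw [hmap, h1, coeff_smul] at h2
    apply hm
    simp only [Units.val_neg, Units.val_one, Int.cast_neg, Int.cast_one, smul_eq_mul] at h2
    linear_combination (-1 / 2 : ℂ) * h2
  obtain ⟨s, hs0, hs⟩ : ∃ s : Fin n ⊕ Fin n →₀ ℕ, (¬ ∀ i, s (Sum.inl i) = 0) ∧
      coeff m (flipX n (monomial s 1)) ≠ 0 := by
    by_contra! hall
    apply hm
    have hlin : G = ∑ s ∈ Q.support, coeff s Q •
        (flipX n (monomial s 1) - flipX n (evalXZero n (monomial s 1))) := by
      rw [hG]
      conv_lhs => rw [Q.as_sum]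
      simp only [map_sum, ← Finset.sum_sub_distrib]
      refine Finset.sum_congr rfl fun s _ => ?_
      have h1 : monomial s (coeff s Q) = coeff s Q • (monomial s 1 : PolyXY n) := by
        rw [smul_monomial, smul_eq_mul, mul_one]
      rw [h1, map_smul, map_smul, map_smul, smul_sub]
    rw [hlin, coeff_sum]
    refine Finset.sum_eq_zero fun s _ => ?_
    rw [coeff_smul, evalXZero_monomial]
    split_ifs with h
    · simp
    · rw [map_zero, sub_zero, hall s (not_forall.mp h), smul_zero]
  obtain ⟨σ, hσ⟩ := (coeff_flipX_monomial_ne_zero_iff s m).mp hs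
  refine hs0 fun i => ?_
  have := eq_of_injective_of_le_perm _ hinj σ (fun i => by have := (hσ i).1; omega) i
  have := (hσ i).1
  omega

theorem flipX_mul_of_invariant {n : ℕ} (f Q : PolyXY n)
    (hQ : ∀ σ : Perm (Fin n), rename (Sum.map σ (1 : Perm (Fin n))) Q = Q) :
    flipX n (f * Q) = evalXZero n Q * flipX n f := by
  rw [flipX_mul, flipX_eq_flipX_evalXZero Q hQ, ← flipX_mul, mul_comm, flipX_mul, mixedOp_evalXZero]

/-- A generator Q acts through multiplication by Q(0, y), which is again an invariant without
constant term. -/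
theorem flipX_mem_invariantIdeal {n : ℕ} {f : PolyXY n} (hf : f ∈ invariantIdeal n) :
    flipX n f ∈ invariantIdeal n := by
  -- The flip is not linear over the polynomial ring, so all multiples are carried through the
  -- induction.
  suffices h : ∀ g, flipX n (g * f) ∈ invariantIdeal n by simpa using h 1
  refine Submodule.span_induction (p := fun f _ => ∀ g, flipX n (g * f) ∈ invariantIdeal n)
    ?_ ?_ ?_ ?_ hf
  · rintro Q ⟨hQ, hQ0⟩ g
    rw [flipX_mul_of_invariant g Q fun σ => hQ σ 1]
    refine Ideal.mul_mem_right _ _ (Ideal.subset_span ⟨fun σ τ => ?_, ?_⟩)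
    · rw [← evalXZero_rename, hQ]
    · rw [constantCoeff_evalXZero, hQ0]
  · simp
  · intro p q _ _ hp hq g
    rw [mul_add, map_add]
    exact add_mem (hp g) (hq g)
  · intro a p _ hp g
    rw [smul_eq_mul, ← mul_assoc]
    exact hp _

theorem flipX_mem_harmonics {n : ℕ} {f : PolyXY n} (hf : f ∈ harmonics n) :
    flipX n f ∈ harmonics n := by
  intro P hP
  change polyPairing _ P (flipX n f) = 0
  rw [polyPairing_flipX]
  exact hf _ (flipX_mem_invariantIdeal hP)

end Pairing


/-! ### The kernel of the flip map -/

section Kernel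

open MvPolynomial

/-- The ideal of `ℂ[x]` generated by the symmetric polynomials without constant term. -/
def symmetricIdeal (n : ℕ) : Ideal (MvPolynomial (Fin n) ℂ) :=
  Ideal.span {g | g.IsSymmetric ∧ constantCoeff g = 0}

/-- The complete homogeneous symmetric polynomial of degree `k` in the variables
`x_i, …, x_{n-1}`. -/
def tailHsymm (n i k : ℕ) : MvPolynomial (Fin n) ℂ :=
  ∑ m ∈ (Finset.univ.filter fun j : Fin n => i ≤ j).finsuppAntidiag k, monomial m 1

theorem mem_finsuppAntidiag_filter {n i k : ℕ} (m : Fin n →₀ ℕ) :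
    m ∈ (Finset.univ.filter fun j : Fin n => i ≤ j).finsuppAntidiag k ↔
      m.degree = k ∧ ∀ j, m j ≠ 0 → i ≤ (j : ℕ) := by
  rw [Finset.mem_finsuppAntidiag]
  have h : m.support ⊆ (Finset.univ.filter fun j : Fin n => i ≤ j) ↔
      ∀ j, m j ≠ 0 → i ≤ (j : ℕ) := by
    simp [Finset.subset_iff]
  rw [h]
  refine and_congr_left fun hm => ?_
  rw [Finsupp.degree_apply]
  have : ∑ j ∈ m.support, m j = ∑ j ∈ Finset.univ.filter fun j : Fin n => i ≤ j, m j :=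
    Finset.sum_subset (h.mpr hm) fun j _ hj => Finsupp.notMem_support_iff.mp hj
  rw [this]

open Classical in
theorem coeff_tailHsymm {n i k : ℕ} (m : Fin n →₀ ℕ) :
    coeff m (tailHsymm n i k) = if m.degree = k ∧ ∀ j, m j ≠ 0 → i ≤ (j : ℕ) then 1 else 0 := by
  rw [tailHsymm, coeff_sum]
  simp only [coeff_monomial]
  rw [Finset.sum_ite_eq']
  simp only [mem_finsuppAntidiag_filter]

/-- The subtracted term collects the monomials divisible by x_i. -/
theorem tailHsymm_succ {n i k : ℕ} (hi : i < n) :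
    tailHsymm n (i + 1) (k + 1) = tailHsymm n i (k + 1) - X ⟨i, hi⟩ * tailHsymm n i k := by
  classical
  ext m
  rw [coeff_sub, coeff_X_mul', coeff_tailHsymm, coeff_tailHsymm]
  by_cases hm : ⟨i, hi⟩ ∈ m.support
  swap
  · rw [if_neg hm, sub_zero]
    refine if_congr (and_congr_right fun _ => forall_congr' fun j => ?_) rfl rfl
    refine imp_congr_right fun hj => ?_
    have : (j : ℕ) ≠ i := by
      rintro rfl
      exact hm (Finsupp.mem_support_iff.mpr hj)
    omega
  · rw [if_pos hm, coeff_tailHsymm]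
    rw [Finsupp.mem_support_iff] at hm
    have hno : ¬(m.degree = k + 1 ∧ ∀ j : Fin n, m j ≠ 0 → i + 1 ≤ (j : ℕ)) :=
      fun h => Nat.not_succ_le_self i (h.2 _ hm)
    rw [if_neg hno]
    obtain ⟨m, rfl⟩ : ∃ m', m = m' + Finsupp.single ⟨i, hi⟩ 1 :=
      ⟨m - Finsupp.single ⟨i, hi⟩ 1, (tsub_add_cancel_of_le (by
        rw [Finsupp.single_le_iff]
        omega)).symm⟩
    rw [add_tsub_cancel_right, eq_comm, sub_eq_zero]
    refine if_congr (and_congr ?_ ?_) rfl rfl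
    · rw [map_add, Finsupp.degree_single]
      omega
    · refine forall_congr' fun j => ?_
      by_cases hj : j = ⟨i, hi⟩
      · subst hj
        simp
      · rw [Finsupp.add_apply, Finsupp.single_eq_of_ne hj, add_zero]

/-- For i = 0 this is a symmetric polynomial of positive degree. The recursion lowers i and the
degree by at most one each, so i < k persists. -/
theorem tailHsymm_mem_symmetricIdeal {n : ℕ} (i k : ℕ) (hi : i < n) (hk : i < k) :
    tailHsymm n i k ∈ symmetricIdeal n := by
  classical
  induction i generalizing k with
  | zero =>
    refine Ideal.subset_span ⟨fun e => ?_, ?_⟩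
    · ext m
      obtain ⟨c, rfl⟩ : ∃ c : Fin n →₀ ℕ, c.mapDomain e = m := by
        refine ⟨m.mapDomain e.symm, ?_⟩
        rw [← Finsupp.mapDomain_comp]
        simp
      rw [coeff_rename_mapDomain _ e.injective, coeff_tailHsymm, coeff_tailHsymm,
        Finsupp.degree_mapDomain]
      simp
    · rw [constantCoeff_eq, coeff_tailHsymm, if_neg]
      rintro ⟨h, -⟩
      rw [map_zero] at h
      omega
  | succ i ih =>
    obtain ⟨k, rfl⟩ := Nat.exists_eq_succ_of_ne_zero (by omega : k ≠ 0)
    rw [Nat.succ_eq_add_one, tailHsymm_succ (by omega : i < n)]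
    exact Ideal.sub_mem _ (ih _ (by omega) (by omega))
      (Ideal.mul_mem_left _ _ (ih _ (by omega) (by omega)))

/-- The ideal of `ℂ[x, y]` generated by the symmetric polynomials in `x` without constant term. -/
def symmetricIdealX (n : ℕ) : Ideal (PolyXY n) :=
  (symmetricIdeal n).map (rename Sum.inl : MvPolynomial (Fin n) ℂ →ₐ[ℂ] PolyXY n)

theorem symmetricIdealX_eq_span (n : ℕ) : symmetricIdealX n = Ideal.span
    ((rename Sum.inl : MvPolynomial (Fin n) ℂ →ₐ[ℂ] PolyXY n) ''
      {g | g.IsSymmetric ∧ constantCoeff g = 0}) :=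
  Ideal.map_span _ _

theorem symmetricIdealX_le (n : ℕ) : symmetricIdealX n ≤ invariantIdeal n := by
  rw [symmetricIdealX_eq_span, Ideal.span_le]
  rintro _ ⟨g, ⟨hg, hg0⟩, rfl⟩
  refine Ideal.subset_span ⟨fun σ τ => ?_, ?_⟩
  · rw [rename_rename]
    have : Sum.map σ τ ∘ Sum.inl = Sum.inl ∘ (σ : Fin n → Fin n) := rfl
    rw [this, ← rename_rename, hg σ]
  · rw [constantCoeff_rename, hg0]

theorem flipX_eq_zero_of_mem_symmetricIdealX {n : ℕ} {f : PolyXY n}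
    (hf : f ∈ symmetricIdealX n) : flipX n f = 0 := by
  suffices h : ∀ g, flipX n (g * f) = 0 by simpa using h 1
  rw [symmetricIdealX_eq_span] at hf
  refine Submodule.span_induction (p := fun f _ => ∀ g, flipX n (g * f) = 0)
    ?_ ?_ ?_ ?_ hf
  · rintro _ ⟨Q, ⟨hQ, hQ0⟩, rfl⟩ g
    rw [flipX_mul_of_invariant]
    · have h : (evalXZero n).comp (rename Sum.inl) =
          (Algebra.ofId ℂ (PolyXY n)).comp (aeval (0 : Fin n → ℂ)) := by
        refine algHom_ext fun i => ?_
        simp [evalXZero]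
      have h2 := DFunLike.congr_fun h Q
      simp only [AlgHom.comp_apply] at h2
      rw [h2, aeval_zero, hQ0]
      simp
    · intro σ
      rw [rename_rename]
      have : Sum.map σ (1 : Perm (Fin n)) ∘ Sum.inl = Sum.inl ∘ (σ : Fin n → Fin n) := rfl
      rw [this, ← rename_rename, hQ σ]
  · simp
  · intro p q _ _ hp hq g
    rw [mul_add, map_add, hp, hq, add_zero]
  · intro a p _ hp g
    rw [smul_eq_mul, ← mul_assoc]
    exact hp _

/-- The exponents `s` with `s(x_i) ≤ i`. -/
def artinExponents (n : ℕ) : Set (Fin n ⊕ Fin n →₀ ℕ) := {s | ∀ i : Fin n, s (Sum.inl i) ≤ i}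

/-- Modulo the ideal, x_i^{i+1} is minus the sum of the other monomials of h_{i+1}(x_i, …, x_{n-1}).
Giving x_l the weight n - l makes these strictly lighter, so the rewriting terminates. -/
theorem monomial_mem_sup_artin {n : ℕ} (s : Fin n ⊕ Fin n →₀ ℕ) :
    monomial s 1 ∈ (symmetricIdealX n).restrictScalars ℂ ⊔ restrictSupport ℂ (artinExponents n) := by
  classical
  let w : (Fin n ⊕ Fin n →₀ ℕ) → ℕ := fun s => ∑ l : Fin n, (n - l) * s (Sum.inl l)
  induction hw : w s using Nat.strong_induction_on generalizing s with
  | _ N ih =>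
  by_cases hs : s ∈ artinExponents n
  · exact Submodule.mem_sup_right ((monomial_mem_restrictSupport ℂ).mpr (Or.inl hs))
  · simp only [artinExponents, Set.mem_ofPred_eq, not_forall, not_le] at hs
    obtain ⟨i, hi⟩ := hs
    obtain ⟨r, rfl⟩ : ∃ r, s = r + Finsupp.single (Sum.inl i) ((i : ℕ) + 1) :=
      ⟨s - Finsupp.single (Sum.inl i) ((i : ℕ) + 1), (tsub_add_cancel_of_le (by
        rw [Finsupp.single_le_iff]
        omega)).symm⟩
    set A := (Finset.univ.filter fun j : Fin n => (i : ℕ) ≤ j).finsuppAntidiag ((i : ℕ) + 1) with hA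
    have hmemA : Finsupp.single i ((i : ℕ) + 1) ∈ A := by
      rw [hA, mem_finsuppAntidiag_filter]
      refine ⟨by simp, fun j hj => ?_⟩
      by_cases h : j = i
      · rw [h]
      · rw [Finsupp.single_eq_of_ne h] at hj
        exact absurd rfl hj
    have hprod : monomial r 1 * rename Sum.inl (tailHsymm n i (i + 1)) =
        ∑ m ∈ A, (monomial (r + m.mapDomain Sum.inl) 1 : PolyXY n) := by
      rw [tailHsymm, map_sum, Finset.mul_sum]
      refine Finset.sum_congr rfl fun m _ => ?_
      rw [rename_monomial, monomial_mul, one_mul]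
    have hmem : monomial r 1 * rename Sum.inl (tailHsymm n i (i + 1)) ∈
        (symmetricIdealX n).restrictScalars ℂ :=
      Ideal.mul_mem_left _ _ (Ideal.mem_map_of_mem _
        (tailHsymm_mem_symmetricIdeal _ _ i.2 (Nat.lt_succ_self _)))
    rw [← Finset.add_sum_erase _ _ hmemA, Finsupp.mapDomain_single] at hprod
    rw [← sub_eq_iff_eq_add] at hprod
    rw [← hprod]
    refine Submodule.sub_mem _ (Submodule.mem_sup_left hmem) (Submodule.sum_mem _ fun m hm => ?_)
    refine ih _ ?_ _ rfl
    rw [← hw]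
    obtain ⟨hne, hmA⟩ := Finset.mem_erase.mp hm
    rw [hA, mem_finsuppAntidiag_filter, Finsupp.degree_eq_sum] at hmA
    have hl : ∀ l : Fin n, (m.mapDomain Sum.inl : Fin n ⊕ Fin n →₀ ℕ) (Sum.inl l) = m l :=
      fun l => Finsupp.mapDomain_apply Sum.inl_injective m l
    simp only [w, Finsupp.add_apply, hl, mul_add, Finset.sum_add_distrib]
    have hsingle : ∑ l : Fin n, (n - l) * (Finsupp.single (Sum.inl i) ((i : ℕ) + 1) :
        Fin n ⊕ Fin n →₀ ℕ) (Sum.inl l) = ∑ l : Fin n, (n - i) * m l := by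
      rw [← Finset.mul_sum, hmA.1, Finset.sum_eq_single i]
      · simp
      · intro l _ hl
        rw [Finsupp.single_eq_of_ne (by simpa using hl), mul_zero]
      · simp
    rw [hsingle]
    refine Nat.add_lt_add_left (Finset.sum_lt_sum (fun l _ => ?_) ?_) _
    · by_cases h : m l = 0
      · simp [h]
      · have := hmA.2 l h
        exact Nat.mul_le_mul_right _ (by omega)
    · by_contra! hall
      apply hne
      have hzero : ∀ l, l ≠ i → m l = 0 := by
        intro l hl
        by_contra h
        have h1 := hall l (Finset.mem_univ l)
        have h2 := Nat.le_of_mul_le_mul_right h1 (Nat.pos_of_ne_zero h)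
        have h3 := hmA.2 l h
        have h4 : (l : ℕ) ≠ i := fun h => hl (Fin.ext h)
        omega
      ext l
      by_cases h : l = i
      · subst h
        rw [Finsupp.single_eq_same, ← hmA.1, Finset.sum_eq_single l (fun b _ hb => hzero b hb)]
        simp
      · rw [Finsupp.single_eq_of_ne h, hzero l h]

/-- Take s in the support minimizing φ(s) = ∑ i s_i, and let m have x-exponents i - s_i and the
y-exponents of s. If r in the support also reaches x^m, through σ, then φ(r) - φ(s) = ∑ i σ(i) - ∑
i² ≤ 0, with equality only for σ = 1. Hence r = s, and the coefficient of the image at m is a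
nonzero multiple of that of a at s. -/
theorem eq_zero_of_flipX_eq_zero_of_artin {n : ℕ} {a : PolyXY n}
    (ha : a ∈ restrictSupport ℂ (artinExponents n)) (h0 : flipX n a = 0) : a = 0 := by
  classical
  by_contra hne
  rw [mem_restrictSupport_iff] at ha
  let φ : (Fin n ⊕ Fin n →₀ ℕ) → ℕ := fun s => ∑ i : Fin n, i * s (Sum.inl i)
  obtain ⟨s, hs, hmin⟩ := Finset.exists_min_image a.support φ (support_nonempty.mpr hne)
  have hsA : ∀ i : Fin n, s (Sum.inl i) ≤ i := ha hs
  let m : Fin n ⊕ Fin n →₀ ℕ := Finsupp.equivFunOnFinite.symm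
    (Sum.elim (fun i => i - s (Sum.inl i)) fun i => s (Sum.inr i))
  have hml : ∀ i : Fin n, m (Sum.inl i) + s (Sum.inl i) = i := by
    intro i
    have := hsA i
    simp only [m, Finsupp.equivFunOnFinite_symm_apply_apply, Sum.elim_inl]
    omega
  have hmr : ∀ i, m (Sum.inr i) = s (Sum.inr i) := fun i => by simp [m]
  have hcoeff : coeff m (flipX n a) = coeff s a * coeff m (flipX n (monomial s 1)) := by
    conv_lhs => rw [a.as_sum]
    rw [map_sum, coeff_sum, Finset.sum_eq_single s]
    · rw [← mul_one (coeff s a), ← smul_eq_mul, ← smul_monomial, map_smul, coeff_smul]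
      simp
    · intro r hr hrs
      rw [← mul_one (coeff r a), ← smul_eq_mul, ← smul_monomial, map_smul, coeff_smul]
      refine smul_eq_zero_of_right _ ?_
      by_contra hc
      obtain ⟨σ, hσ⟩ := (coeff_flipX_monomial_ne_zero_iff r m).mp hc
      have hφ := hmin r hr
      have h1 : ∑ i : Fin n, (i : ℕ) * (σ i : ℕ) + φ s = ∑ i : Fin n, (i : ℕ) * (i : ℕ) + φ r := by
        simp only [φ, ← Finset.sum_add_distrib]
        refine Finset.sum_congr rfl fun i _ => ?_
        rw [← mul_add, ← mul_add, ← (hσ i).1]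
        congr 1
        have := hml i
        omega
      -- The equality case of the rearrangement inequality: this sum is 2(∑ i² - ∑ i σ(i)).
      have h2 : ∑ i : Fin n, ((i : ℕ) - (σ i : ℕ) : ℤ) ^ 2 ≤ 0 := by
        have h3 : ∑ i : Fin n, ((σ i : ℕ) : ℤ) ^ 2 = ∑ i : Fin n, ((i : ℕ) : ℤ) ^ 2 :=
          Equiv.sum_comp σ fun i => ((i : ℕ) : ℤ) ^ 2
        have h4 : ∑ i : Fin n, ((i : ℕ) : ℤ) ^ 2 ≤ ∑ i : Fin n, ((i : ℕ) : ℤ) * (σ i : ℕ) := by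
          simp only [sq]
          exact_mod_cast (by omega :
            ∑ i : Fin n, (i : ℕ) * (i : ℕ) ≤ ∑ i : Fin n, (i : ℕ) * (σ i : ℕ))
        simp only [sub_sq, Finset.sum_add_distrib, Finset.sum_sub_distrib, h3, mul_assoc,
          ← Finset.mul_sum]
        linarith
      have h3 := (Finset.sum_eq_zero_iff_of_nonneg fun i _ => sq_nonneg _).mp
        (le_antisymm h2 (Finset.sum_nonneg fun i _ => sq_nonneg _))
      apply hrs
      ext (i | i)
      · have h4 := h3 i (Finset.mem_univ i)
        have h5 : ((i : ℕ) : ℤ) - (σ i : ℕ) = 0 := by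
          simpa using h4
        have := (hσ i).1
        have := hml i
        omega
      · rw [← (hσ i).2, hmr]
    · intro h
      exact absurd hs h
  rw [h0, coeff_zero] at hcoeff
  refine mul_ne_zero (mem_support_iff.mp hs) ?_ hcoeff.symm
  exact (coeff_flipX_monomial_ne_zero_iff s m).mpr ⟨1, fun i => ⟨hml i, hmr i⟩⟩

/-- Split f into a part in the ideal of symmetric polynomials in x, which the flip kills, and an
Artin part, on which the flip is injective. -/
theorem mem_invariantIdeal_of_flipX_eq_zero {n : ℕ} {f : PolyXY n} (h0 : flipX n f = 0) :
    f ∈ invariantIdeal n := by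
  have hf : f ∈ (symmetricIdealX n).restrictScalars ℂ ⊔ restrictSupport ℂ (artinExponents n) := by
    rw [f.as_sum]
    refine Submodule.sum_mem _ fun s _ => ?_
    rw [← mul_one (coeff s f), ← smul_eq_mul, ← smul_monomial]
    exact Submodule.smul_mem _ _ (monomial_mem_sup_artin s)
  obtain ⟨j, hj, a, ha, rfl⟩ := Submodule.mem_sup.mp hf
  rw [map_add, flipX_eq_zero_of_mem_symmetricIdealX hj, zero_add] at h0
  rw [eq_zero_of_flipX_eq_zero_of_artin ha h0, add_zero]
  exact symmetricIdealX_le n hj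

end Kernel


/-! ### Symmetries of the bigraded characters -/

section Characters

open MvPolynomial

theorem weight_bidegree {n : ℕ} (s : Fin n ⊕ Fin n →₀ ℕ) :
    Finsupp.weight (bidegree n) s = (∑ i, s (Sum.inl i), ∑ i, s (Sum.inr i)) := by
  rw [Finsupp.weight_apply, Finsupp.sum_fintype _ _ (by simp), Fintype.sum_sum_type]
  ext <;> simp [bidegree, Prod.fst_sum, Prod.snd_sum]

theorem IsFlipPair.weight {n : ℕ} {σ : Perm (Fin n)} {s m : Fin n ⊕ Fin n →₀ ℕ}
    (h : IsFlipPair σ s m) :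
    (Finsupp.weight (bidegree n) s).1 + (Finsupp.weight (bidegree n) m).1 = n.choose 2 ∧
      (Finsupp.weight (bidegree n) m).2 = (Finsupp.weight (bidegree n) s).2 := by
  rw [weight_bidegree, weight_bidegree]
  refine ⟨?_, show ∑ i, m (Sum.inr i) = ∑ i, s (Sum.inr i) from
    Finset.sum_congr rfl fun i _ => (h i).2⟩
  simp only [← Finset.sum_add_distrib]
  rw [Finset.sum_congr rfl fun i _ => (add_comm _ _).trans (h i).1,
    Equiv.sum_comp σ fun i => (i : ℕ), Fin.sum_univ_eq_sum_range fun i => i, Finset.sum_range_id,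
    Nat.choose_two_right]

theorem weightedHomogeneousComponent_monomial_one {n : ℕ} (d : ℕ × ℕ) (s : Fin n ⊕ Fin n →₀ ℕ) :
    weightedHomogeneousComponent (bidegree n) d (monomial s (1 : ℂ)) =
      if Finsupp.weight (bidegree n) s = d then monomial s 1 else 0 := by
  classical
  ext m
  rw [coeff_weightedHomogeneousComponent, coeff_monomial]
  by_cases h : s = m
  · subst h
    rw [if_pos rfl]
    split_ifs <;> simp
  · split_ifs <;> simp [coeff_monomial, h]

theorem flipX_weightedHomogeneousComponent {n j j' : ℕ} (h : j + j' = n.choose 2) (k : ℕ)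
    (p : PolyXY n) :
    flipX n (weightedHomogeneousComponent (bidegree n) (j, k) p) =
      weightedHomogeneousComponent (bidegree n) (j', k) (flipX n p) := by
  classical
  have hlin : (flipX n).comp (weightedHomogeneousComponent (bidegree n) (j, k)) =
      (weightedHomogeneousComponent (bidegree n) (j', k)).comp (flipX n) := by
    refine (basisMonomials _ ℂ).ext fun s => ?_
    simp only [coe_basisMonomials, LinearMap.comp_apply]
    ext m
    rw [weightedHomogeneousComponent_monomial_one, coeff_weightedHomogeneousComponent]
    by_cases hc : coeff m (flipX n (monomial s 1)) = 0
    · split_ifs <;> simp [hc]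
    · obtain ⟨σ, hσ⟩ := (coeff_flipX_monomial_ne_zero_iff s m).mp hc
      have hw := hσ.weight
      by_cases h1 : Finsupp.weight (bidegree n) s = (j, k)
      · rw [if_pos h1, if_pos]
        rw [h1] at hw
        exact Prod.ext (by simp only at hw ⊢; omega) hw.2
      · rw [if_neg h1, if_neg, map_zero, coeff_zero]
        intro h2
        rw [h2] at hw
        exact h1 (Prod.ext (by simp only at hw ⊢; omega) hw.2.symm)
  exact DFunLike.congr_fun hlin p

theorem flipX_weightedHomogeneousComponent_eq_zero {n j : ℕ} (h : n.choose 2 < j) (k : ℕ)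
    (p : PolyXY n) :
    flipX n (weightedHomogeneousComponent (bidegree n) (j, k) p) = 0 := by
  classical
  have hlin : (flipX n).comp (weightedHomogeneousComponent (bidegree n) (j, k)) = 0 := by
    refine (basisMonomials _ ℂ).ext fun s => ?_
    simp only [coe_basisMonomials, LinearMap.comp_apply, LinearMap.zero_apply]
    rw [weightedHomogeneousComponent_monomial_one]
    split_ifs with h1
    · ext m
      by_contra hc
      obtain ⟨σ, hσ⟩ := (coeff_flipX_monomial_ne_zero_iff s m).mp hc
      have hw := hσ.weight.1
      rw [h1] at hw
      simp only at hw
      omega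
    · rw [map_zero]
  exact DFunLike.congr_fun hlin p

theorem eq_zero_of_flipX_eq_zero {n : ℕ} {d : ℕ × ℕ} {v : PolyXY n}
    (hv : v ∈ (bigradedPiece (harmonicsRep n) d).toSubmodule) (h : flipX n v = 0) : v = 0 :=
  eq_zero_of_mem_invariantIdeal_of_mem_bigradedPiece hv (mem_invariantIdeal_of_flipX_eq_zero h)

theorem flipX_mem_bigradedPiece {n j j' : ℕ} (h : j + j' = n.choose 2) (k : ℕ) {v : PolyXY n}
    (hv : v ∈ (bigradedPiece (harmonicsRep n) (j, k)).toSubmodule) :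
    flipX n v ∈ (bigradedPiece (harmonicsRep n) (j', k)).toSubmodule := by
  obtain ⟨p, hp, rfl⟩ := hv
  exact ⟨flipX n p, flipX_mem_harmonics hp, (flipX_weightedHomogeneousComponent h k p).symm⟩

theorem finiteDimensional_bigradedPiece {n : ℕ} (V : Subrepresentation (diagonalRep n))
    (d : ℕ × ℕ) : FiniteDimensional ℂ (bigradedPiece V d).toSubmodule := by
  classical
  set S : Set (Fin n ⊕ Fin n →₀ ℕ) := {s | Finsupp.weight (bidegree n) s = d} with hS
  have hfin : S.Finite := by
    refine (Set.finite_Iic (Finsupp.equivFunOnFinite.symm fun _ => d.1 + d.2)).subset ?_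
    rintro s hs i
    have hs : Finsupp.weight (bidegree n) s = d := hs
    rw [weight_bidegree] at hs
    rw [← hs]
    rcases i with i | i
    · exact (Finset.single_le_sum (f := fun i => s (Sum.inl i)) (fun _ _ => Nat.zero_le _)
        (Finset.mem_univ i)).trans (Nat.le_add_right _ _)
    · exact (Finset.single_le_sum (f := fun i => s (Sum.inr i)) (fun _ _ => Nat.zero_le _)
        (Finset.mem_univ i)).trans (Nat.le_add_left _ _)
  have : Finite S := hfin
  have : FiniteDimensional ℂ (restrictSupport ℂ S) :=
    Module.Finite.of_basis (basisRestrictSupport ℂ S)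
  refine Submodule.finiteDimensional_of_le (S₂ := restrictSupport ℂ S) ?_
  rintro _ ⟨p, -, rfl⟩
  rw [mem_restrictSupport_iff]
  intro s hs
  rw [Finset.mem_coe, mem_support_iff, coeff_weightedHomogeneousComponent] at hs
  by_contra h
  exact hs (if_neg h)

/-- Two subrepresentations that inject into each other, with a map that commutes with `g` up to
the scalar `c`, have characters that agree at `g` up to `c`. -/
theorem character_eq_mul_of_injective {G V : Type*} [Group G] [AddCommGroup V] [Module ℂ V]
    {ρ : Representation ℂ G V} (W W' : Subrepresentation ρ)
    [FiniteDimensional ℂ W.toSubmodule] [FiniteDimensional ℂ W'.toSubmodule]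
    (L L' : V →ₗ[ℂ] V) (hL : ∀ v ∈ W.toSubmodule, L v ∈ W'.toSubmodule)
    (hL' : ∀ v ∈ W'.toSubmodule, L' v ∈ W.toSubmodule)
    (hinj : ∀ v ∈ W.toSubmodule, L v = 0 → v = 0)
    (hinj' : ∀ v ∈ W'.toSubmodule, L' v = 0 → v = 0) (g : G) (c : ℂ)
    (hc : ∀ v, ρ g (L v) = c • L (ρ g v)) :
    W'.toRepresentation.character g = c * W.toRepresentation.character g := by
  let f : W.toSubmodule →ₗ[ℂ] W'.toSubmodule := L.restrict hL
  let f' : W'.toSubmodule →ₗ[ℂ] W.toSubmodule := L'.restrict hL'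
  have hf : Function.Injective f := by
    rw [injective_iff_map_eq_zero]
    intro v hv
    exact Subtype.ext (hinj v v.2 (congrArg Subtype.val hv))
  have hf' : Function.Injective f' := by
    rw [injective_iff_map_eq_zero]
    intro v hv
    exact Subtype.ext (hinj' v v.2 (congrArg Subtype.val hv))
  -- Injections both ways force equal dimensions, so `L` is bijective without `L'` being its
  -- inverse.
  let e := f.linearEquivOfInjective hf (le_antisymm (LinearMap.finrank_le_finrank_of_injective hf)
    (LinearMap.finrank_le_finrank_of_injective hf'))
  have he : ∀ v, ((e v : W'.toSubmodule) : V) = L v := fun v => rfl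
  have h : W'.toRepresentation g = c • e.conj (W.toRepresentation g) := by
    refine LinearMap.ext fun v => ?_
    obtain ⟨u, rfl⟩ := e.surjective v
    apply Subtype.ext
    rw [LinearMap.smul_apply, LinearEquiv.conj_apply_apply, LinearEquiv.symm_apply_apply]
    change ρ g (e u : V) = c • ((e (W.toRepresentation g u) : W'.toSubmodule) : V)
    rw [he, he, hc]
    rfl
  rw [Representation.character, Representation.character, h, map_smul, LinearMap.trace_conj',
    smul_eq_mul]

theorem character_bigradedPiece_flip {n j j' : ℕ} (h : j + j' = n.choose 2) (k : ℕ)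
    (g : Perm (Fin n)) :
    (bigradedPiece (harmonicsRep n) (j', k)).toRepresentation.character g =
      ((Perm.sign g : ℤ) : ℂ) *
        (bigradedPiece (harmonicsRep n) (j, k)).toRepresentation.character g := by
  have := finiteDimensional_bigradedPiece (harmonicsRep n) (j, k)
  have := finiteDimensional_bigradedPiece (harmonicsRep n) (j', k)
  have hs : ((Perm.sign g : ℤ) : ℂ) * ((Perm.sign g : ℤ) : ℂ) = 1 := by
    rcases Int.units_eq_one_or (Perm.sign g) with h | h <;> simp [h]
  refine character_eq_mul_of_injective _ _ (flipX n) (flipX n)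
    (fun v hv => flipX_mem_bigradedPiece h k hv)
    (fun v hv => flipX_mem_bigradedPiece ((add_comm _ _).trans h) k hv)
    (fun v hv => eq_zero_of_flipX_eq_zero hv) (fun v hv => eq_zero_of_flipX_eq_zero hv) g _
    fun v => ?_
  rw [diagonalRep_apply, diagonalRep_apply, flipX_rename, smul_smul, hs, one_smul]

theorem character_bigradedPiece_eq_zero {n j : ℕ} (h : n.choose 2 < j) (k : ℕ)
    (g : Perm (Fin n)) :
    (bigradedPiece (harmonicsRep n) (j, k)).toRepresentation.character g = 0 := by
  have hzero : ∀ v : (bigradedPiece (harmonicsRep n) (j, k)).toSubmodule, v = 0 := by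
    rintro ⟨v, hv⟩
    refine Subtype.ext (eq_zero_of_flipX_eq_zero hv ?_)
    obtain ⟨p, -, rfl⟩ := hv
    exact flipX_weightedHomogeneousComponent_eq_zero h k p
  have : (bigradedPiece (harmonicsRep n) (j, k)).toRepresentation g = 0 :=
    LinearMap.ext fun v => hzero _
  rw [Representation.character, this, map_zero]

theorem rename_swap_mem_harmonics {n : ℕ} {p : PolyXY n} (hp : p ∈ harmonics n) :
    rename Sum.swap p ∈ harmonics n := by
  intro P hP
  have hle : invariantIdeal n ≤ (invariantIdeal n).comap (rename (R := ℂ) Sum.swap) := by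
    refine Ideal.span_le.mpr ?_
    rintro f ⟨hf, hf0⟩
    refine Ideal.subset_span ⟨fun σ τ => ?_, ?_⟩
    · change rename _ (rename Sum.swap f) = rename Sum.swap f
      rw [rename_rename]
      have : Sum.map σ τ ∘ Sum.swap = Sum.swap ∘ Sum.map τ σ := by
        funext i
        rcases i with i | i <;> rfl
      rw [this, ← rename_rename, hf]
    · change constantCoeff (rename Sum.swap f) = 0
      rw [constantCoeff_rename, hf0]
  have h0 := hp _ (hle hP)
  change polyPairing _ (rename (Equiv.sumComm _ _) P) p = 0 at h0
  change polyPairing _ P (rename (Equiv.sumComm _ _) p) = 0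
  have hP2 : P = rename (Equiv.sumComm (Fin n) (Fin n))
      (rename (Equiv.sumComm (Fin n) (Fin n)) P) := by
    have hid : ⇑(Equiv.sumComm (Fin n) (Fin n)) ∘ ⇑(Equiv.sumComm (Fin n) (Fin n)) = id :=
      funext Sum.swap_swap
    rw [rename_rename, hid, rename_id_apply]
  rw [polyPairing_apply] at h0 ⊢
  rw [hP2, diffOp_rename, aeval_rename]
  exact h0

theorem rename_swap_weightedHomogeneousComponent {n : ℕ} (d : ℕ × ℕ) (p : PolyXY n) :
    rename Sum.swap (weightedHomogeneousComponent (bidegree n) d p) =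
      weightedHomogeneousComponent (bidegree n) d.swap (rename Sum.swap p) := by
  classical
  have hlin : (rename (R := ℂ) Sum.swap).toLinearMap.comp
        (weightedHomogeneousComponent (bidegree n) d) =
      (weightedHomogeneousComponent (bidegree n) d.swap).comp
        (rename (R := ℂ) Sum.swap).toLinearMap := by
    refine (basisMonomials _ ℂ).ext fun s => ?_
    simp only [coe_basisMonomials, LinearMap.comp_apply, AlgHom.toLinearMap_apply]
    rw [rename_monomial, weightedHomogeneousComponent_monomial_one,
      weightedHomogeneousComponent_monomial_one]
    have hw : Finsupp.weight (bidegree n) (s.mapDomain Sum.swap) =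
        (Finsupp.weight (bidegree n) s).swap := by
      have hl : ∀ a, s.mapDomain (Equiv.sumComm (Fin n) (Fin n)) a = s a.swap := fun a => by
        rw [Finsupp.mapDomain_equiv_apply]
        rfl
      have hl' : ∀ a : Fin n ⊕ Fin n, s.mapDomain Sum.swap a = s a.swap := hl
      rw [weight_bidegree, weight_bidegree]
      simp [hl']
    rw [hw]
    simp only [Prod.swap_inj]
    split_ifs
    · rw [rename_monomial]
    · rw [map_zero]
  exact DFunLike.congr_fun hlin p

theorem character_bigradedPiece_swap {n : ℕ} (j k : ℕ) (g : Perm (Fin n)) :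
    (bigradedPiece (harmonicsRep n) (k, j)).toRepresentation.character g =
      (bigradedPiece (harmonicsRep n) (j, k)).toRepresentation.character g := by
  have := finiteDimensional_bigradedPiece (harmonicsRep n) (j, k)
  have := finiteDimensional_bigradedPiece (harmonicsRep n) (k, j)
  have hmem : ∀ d : ℕ × ℕ, ∀ v ∈ (bigradedPiece (harmonicsRep n) d).toSubmodule,
      (rename (R := ℂ) Sum.swap).toLinearMap v ∈
        (bigradedPiece (harmonicsRep n) d.swap).toSubmodule := by
    rintro d _ ⟨p, hp, rfl⟩
    exact ⟨rename Sum.swap p, rename_swap_mem_harmonics hp,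
      (rename_swap_weightedHomogeneousComponent d p).symm⟩
  have hinj : ∀ v : PolyXY n, (rename (R := ℂ) Sum.swap).toLinearMap v = 0 → v = 0 := by
    intro v hv
    exact rename_injective _ (Equiv.sumComm (Fin n) (Fin n)).injective (hv.trans (map_zero _).symm)
  refine (character_eq_mul_of_injective (bigradedPiece (harmonicsRep n) (j, k))
    (bigradedPiece (harmonicsRep n) (k, j)) (rename Sum.swap).toLinearMap
    (rename Sum.swap).toLinearMap (hmem (j, k)) (hmem (k, j)) (fun v _ => hinj v)
    (fun v _ => hinj v) g 1 fun v => ?_).trans (one_mul _)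
  rw [one_smul, diagonalRep_apply, diagonalRep_apply, AlgHom.toLinearMap_apply,
    AlgHom.toLinearMap_apply, rename_rename, rename_rename]
  congr 2
  funext i
  rcases i with i | i <;> rfl

end Characters

/-! ### Symmetries of the bigraded Frobenius characteristic -/

section Frobenius

variable {K : Type*} [Field K] [Algebra ℂ K]

theorem frobeniusChar_swap (n j k : ℕ) :
    frobeniusChar K (bigradedPiece (harmonicsRep n) (k, j)) =
      frobeniusChar K (bigradedPiece (harmonicsRep n) (j, k)) := by
  simp only [frobeniusChar, character_bigradedPiece_swap j k]

theorem frobeniusChar_eq_zero_of_lt_fst {n j : ℕ} (h : n.choose 2 < j) (k : ℕ) :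
    frobeniusChar K (bigradedPiece (harmonicsRep n) (j, k)) = 0 := by
  simp [frobeniusChar, character_bigradedPiece_eq_zero h k]

theorem omegaHom_frobeniusChar {n j j' : ℕ} (h : j + j' = n.choose 2) (k : ℕ) :
    omegaHom K (frobeniusChar K (bigradedPiece (harmonicsRep n) (j, k))) =
      frobeniusChar K (bigradedPiece (harmonicsRep n) (j', k)) := by
  rw [frobeniusChar, frobeniusChar, map_smul, map_sum]
  congr 1
  refine Finset.sum_congr rfl fun g _ => ?_
  rw [map_smul, omegaHom_pSymPart, smul_smul, character_bigradedPiece_flip h k, map_mul, mul_comm]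
  simp

/-- The flip kills x-degrees above binom(n,2) yet is injective on the pieces, so these pieces
vanish; the bound in y follows by exchanging x and y. -/
theorem frobF_eq_sum (n : ℕ) (q t : K) :
    frobF n q t = ∑ j ∈ Finset.range (n.choose 2 + 1), ∑ k ∈ Finset.range (n.choose 2 + 1),
      (q ^ j * t ^ k) • frobeniusChar K (bigradedPiece (harmonicsRep n) (j, k)) := by
  rw [frobF, bigradedFrobenius, ← Finset.sum_product']
  refine finsum_eq_finsetSum_of_support_subset _ fun d hd => ?_
  rw [Function.mem_support] at hd
  rw [Finset.mem_coe, Finset.mem_product, Finset.mem_range, Finset.mem_range]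
  constructor
  · by_contra h
    exact hd (by rw [frobeniusChar_eq_zero_of_lt_fst (by omega), smul_zero])
  · by_contra h
    exact hd (by rw [frobeniusChar_swap, frobeniusChar_eq_zero_of_lt_fst (by omega), smul_zero])

theorem frobF_swap (n : ℕ) (q t : K) : frobF n t q = frobF n q t := by
  rw [frobF_eq_sum, frobF_eq_sum, Finset.sum_comm]
  refine Finset.sum_congr rfl fun j _ => Finset.sum_congr rfl fun k _ => ?_
  rw [frobeniusChar_swap, mul_comm]

theorem omegaHom_frobF (n : ℕ) (q t : K) (hq : q ≠ 0) :
    omegaHom K (frobF n q t) = q ^ n.choose 2 • frobF n q⁻¹ t := by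
  -- Reindexing the left side by j ↦ binom(n,2) - j matches the reflection of degrees by the flip.
  rw [frobF_eq_sum, frobF_eq_sum, Finset.smul_sum, map_sum, ← Finset.sum_flip]
  refine Finset.sum_congr rfl fun j hj => ?_
  rw [Finset.mem_range] at hj
  rw [map_sum, Finset.smul_sum]
  refine Finset.sum_congr rfl fun k _ => ?_
  rw [map_smul, omegaHom_frobeniusChar (j' := j) (by omega), smul_smul, ← mul_assoc, inv_pow,
    ← div_eq_mul_inv, pow_sub₀ q hq (by omega), div_eq_mul_inv]

end Frobenius

end

theorem mainTheorem5 {K : Type*} [Field K] [Algebra ℂ K] :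
    (∃! ω : SymFun K →ₗ[K] SymFun K, ∀ μ : YoungDiagram, ω (schur K μ) = schur K μ.transpose) ∧
    ∀ (n : ℕ) (q t : K),
      frobF n t q = frobF n q t ∧
      (q ≠ 0 → t ≠ 0 → frobF n t q = (q * t) ^ n.choose 2 • frobF n q⁻¹ t⁻¹) ∧
      ∀ ω : SymFun K →ₗ[K] SymFun K,
        (∀ μ : YoungDiagram, ω (schur K μ) = schur K μ.transpose) →
          (q ≠ 0 → ω (frobF n q t) = q ^ n.choose 2 • frobF n q⁻¹ t) ∧
          (t ≠ 0 → ω (frobF n q t) = t ^ n.choose 2 • frobF n q t⁻¹) := by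
  have ht : ∀ (n : ℕ) (q t : K), t ≠ 0 →
      omegaHom K (frobF n q t) = t ^ n.choose 2 • frobF n q t⁻¹ := by
    intro n q t h
    rw [← frobF_swap, omegaHom_frobF n t q h, frobF_swap]
  refine ⟨existsUnique_omega, fun n q t => ⟨frobF_swap n q t, fun hq h => ?_, fun ω hω => ?_⟩⟩
  -- The inversions of q and of t each cost one ω, and the two cancel.
  · rw [frobF_swap, mul_pow, mul_comm, mul_smul, ← omegaHom_frobF n q t⁻¹ hq, ← map_smul,
      ← ht n q t h, omegaHom_omegaHom]
  · rw [eq_omegaHom_of_schur ω hω]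
    exact ⟨omegaHom_frobF n q t, ht n q t⟩
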